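/- **Notation.** Let $U=\{\begin{pmatrix}1&t\\0&1\end{pmatrix}: t\in\mathbb R\}$ and $B=\{\begin{pmatrix}\lambda&t\\0&\lambda^{-1}\end{pmatrix}: t\in\mathbb R,\ \lambda>0\}$ in $PSL(2,\mathbb R)$. A *transversely homogeneous foliation by surfaces* $\mathcal F$ of a compact connected manifold $M=\Gamma\backslash\widetilde M$ (where the group $\Gamma$ acts smoothly, freely and properly discontinuously on the connected manifold $\widetilde M$) is a foliation induced by the fibres of a locally trivial smooth fibration $\rho:\widetilde M\to N$ with connected two-dimensional fibres, where $N$ is a homogeneous space of a connected Lie group $G$ and $\rho(\gamma x)=h(\gamma)\rho(x)$ for a homomorphism $h:\Gamma\to G$. It is *minimal* if all its leaves are dense. It is a foliation *by hyperbolic surfaces* if $M$ carries a Riemannian metric (that is, $\widetilde M$ carries a $\Gamma$-invariant one) for which every leaf is, compatibly with a continuous orientation of the leaves, a quotient of the hyperbolic plane $\mathbb H$ by a discrete torsion-free subgroup of $PSL(2,\mathbb R)$. Then $PSL(2,\mathbb R)$ acts continuously on the right on the unit tangent bundle $X=T^1\mathcal F$: if $v$ is the image of the upward unit vector at $i$ under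 the uniformization $\varphi_v:\mathbb H\to L$ of its leaf, then $v\cdot g$ is the image of the same vector under $\varphi_v\circ g$. An action is *minimal* if all its orbits are dense; a *minimal set* of an action is a nonempty closed invariant set which is minimal for inclusion among such sets. **Theorem.** There exist minimal transversely homogeneous foliations by hyperbolic surfaces on compact manifolds such that neither the $U$-action nor the $B$-action on the unit tangent bundle is minimal. Moreover, let $A\in SL(2,\mathbb Z)$ with $\operatorname{tr}A>2$, and let $T^3_A=\Gamma\backslash(\mathbb R^2\times\mathbb R)$, where $\Gamma$ is generated by $(x,t)\mapsto(x+e_1,t)$, $(x,t)\mapsto(x+e_2,t)$ and $(x,t)\mapsto(Ax,t+1)$. There are $\lambda>1$ and $u,v\in\mathbb R^2$ with $Au=\lambda u$, $Av=\lambda^{-1}v$, $\det(u|v)=1$, such that the foliation $\mathcal F$ of $T^3_A$ induced by the fibres of $(x,t)\mapsto\det(u|x)$, with the leafwise metric $\lambda^{-2t}(dx')^2+(\log\lambda)^2\,dt^2$ (where $x=x'u+y'v$), is a minimal transversely homogeneous foliation by hyperbolic surfaces, neither the $U$-action nor the $B$-action on $T^1\mathcal F$ is minimal, the $B$-action on $T^1\mathcal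 F$ has a unique minimal set, and this set is not a minimal set of the $U$-action. -/

import Mathlib

open scoped Manifold ContDiff MatrixGroups

noncomputable section

namespace HorocycleFoliation

/-! ### Subgroups of `SL(2, ℝ)`

`PSL(2, ℝ)` acts through `SL(2, ℝ)`: the matrix `-1` acts trivially on the upper half plane, hence
on all the spaces below, and the subgroups `U` and `B` of `SL(2, ℝ)` defined here map isomorphically
onto the subgroups of `PSL(2, ℝ)` with the same names. -/

/-- The upper triangular matrices with positive diagonal entries. -/
def subgroupB : Subgroup SL(2, ℝ) where
  carrier := {g | g 1 0 = 0 ∧ 0 < g 0 0 ∧ 0 < g 1 1}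
  one_mem' := by simp
  mul_mem' := by
    rintro a b ⟨ha, ha0, ha1⟩ ⟨hb, hb0, hb1⟩
    simp only [Set.mem_ofPred_eq, Matrix.SpecialLinearGroup.coe_mul, Matrix.mul_apply,
      Fin.sum_univ_two, ha, hb]
    refine ⟨by ring, ?_, ?_⟩ <;> simp <;> positivity
  inv_mem' := by
    rintro a ⟨ha, ha0, ha1⟩
    simp [Matrix.SpecialLinearGroup.coe_inv, Matrix.adjugate_fin_two, ha, ha0, ha1]

/-- The upper triangular unipotent matrices. -/
def subgroupU : Subgroup SL(2, ℝ) where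
  carrier := {g | g 1 0 = 0 ∧ g 0 0 = 1 ∧ g 1 1 = 1}
  one_mem' := by simp
  mul_mem' := by
    rintro a b ⟨ha, ha0, ha1⟩ ⟨hb, hb0, hb1⟩
    simp [Matrix.mul_apply, ha, hb, ha0, ha1, hb0, hb1]
  inv_mem' := by
    rintro a ⟨ha, ha0, ha1⟩
    simp [Matrix.SpecialLinearGroup.coe_inv, Matrix.adjugate_fin_two, ha, ha0, ha1]

/-! ### Minimal sets -/

/-- `S` is a (nonempty) minimal set of the action of `A` on `X`: it is closed, nonempty and
invariant, and no proper subset has these three properties. -/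
def IsMinimalSet (A : Type*) {X : Type*} [TopologicalSpace X] [SMul A X] (S : Set X) : Prop :=
  Minimal (fun T : Set X => IsClosed T ∧ T.Nonempty ∧ ∀ (a : A), ∀ x ∈ T, a • x ∈ T) S

/-! ### Möbius transformations as maps of real manifolds -/

lemma hasMFDerivAt_smul (g : SL(2, ℝ)) (z : UpperHalfPlane) :
    HasMFDerivAt 𝓘(ℝ, ℂ) 𝓘(ℝ, ℂ) (fun w : UpperHalfPlane => g • w) z
      (UpperHalfPlane.smulFDeriv (g : GL (Fin 2) ℝ) z) := by
  refine ⟨(continuous_const_smul g).continuousAt, ?_⟩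
  have h := (UpperHalfPlane.hasStrictFDerivAt_smul (g : GL (Fin 2) ℝ) z).hasFDerivAt
  exact h.hasFDerivWithinAt

lemma norm_smulFDeriv (g : SL(2, ℝ)) (z : UpperHalfPlane) (w : ℂ) :
    ‖UpperHalfPlane.smulFDeriv (g : GL (Fin 2) ℝ) z w‖ ^ 2 / (g • z).im ^ 2
      = ‖w‖ ^ 2 / z.im ^ 2 := by
  have hd := UpperHalfPlane.denom_ne_zero (g : GL (Fin 2) ℝ) z
  have h1 : (g • z).im = z.im / Complex.normSq (UpperHalfPlane.denom (g : GL (Fin 2) ℝ) z) := by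
    have := UpperHalfPlane.im_smul_eq_div_normSq (g : GL (Fin 2) ℝ) z
    simp only [Matrix.SpecialLinearGroup.coeToGL_det, Units.val_one, abs_one, one_mul] at this
    exact this
  have hz := z.im_pos.ne'
  have hn : ‖UpperHalfPlane.denom (g : GL (Fin 2) ℝ) z‖ ≠ 0 := norm_ne_zero_iff.mpr hd
  rw [h1, Complex.normSq_eq_norm_sq]
  simp [UpperHalfPlane.smulFDeriv, UpperHalfPlane.σ]
  field_simp

/-! ### Transversely homogeneous foliations by surfaces -/

section Foliation

variable {E M F N Γ : Type}
  [NormedAddCommGroup E] [NormedSpace ℝ E]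
  [TopologicalSpace M] [ChartedSpace E M] [IsManifold 𝓘(ℝ, E) ∞ M]
  [NormedAddCommGroup F] [NormedSpace ℝ F]
  [TopologicalSpace N] [ChartedSpace F N]
  [Group Γ] [MulAction Γ M]

variable (E F) in
/-- `ρ : M → N` is a locally trivial smooth fibration whose fibres are surfaces. -/
def IsSurfaceFibration (ρ : M → N) : Prop :=
  ∀ y : N, ∃ (L : Type) (_ : TopologicalSpace L) (_ : ChartedSpace (EuclideanSpace ℝ (Fin 2)) L)
    (_ : IsManifold (𝓡 2) ∞ L) (V : Set N) (Φ : OpenPartialHomeomorph M (N × L)),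
    IsOpen V ∧ y ∈ V ∧ Φ.source = ρ ⁻¹' V ∧ Φ.target = V ×ˢ Set.univ ∧
    (∀ x ∈ ρ ⁻¹' V, (Φ x).1 = ρ x) ∧
    ContMDiffOn 𝓘(ℝ, E) (𝓘(ℝ, F).prod (𝓡 2)) ∞ Φ Φ.source ∧
    ContMDiffOn (𝓘(ℝ, F).prod (𝓡 2)) 𝓘(ℝ, E) ∞ Φ.symm Φ.target

variable (F Γ) in
/-- `N` is a homogeneous space of a connected Lie group `G` (that is, `G` acts smoothly and
transitively on `N`), and `ρ : M → N` is equivariant along a group homomorphism `Γ → G`. -/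
def IsHomogeneousEquivariant (ρ : M → N) : Prop :=
  ∃ (V : Type) (_ : NormedAddCommGroup V) (_ : NormedSpace ℝ V) (_ : FiniteDimensional ℝ V)
    (G : Type) (_ : TopologicalSpace G) (_ : ChartedSpace V G) (_ : Group G)
    (_ : LieGroup 𝓘(ℝ, V) ∞ G) (_ : T2Space G) (_ : ConnectedSpace G)
    (_ : MulAction G N) (h : Γ →* G),
    MulAction.IsPretransitive G N ∧
    ContMDiff (𝓘(ℝ, V).prod 𝓘(ℝ, F)) 𝓘(ℝ, F) ∞ (fun p : G × N => p.1 • p.2) ∧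
    ∀ (γ : Γ) (x : M), ρ (γ • x) = h γ • ρ x

variable (E M F N Γ) in
/-- A transversely homogeneous foliation by surfaces of the compact connected manifold `Γ \ M`,
where `Γ` acts on the connected manifold `M` smoothly, freely and properly discontinuously: it is
induced by the foliation of `M` by the fibres of an equivariant locally trivial smooth fibration
`dev` of `M` over a homogeneous space `N` of a Lie group, with connected fibres of dimension 2. -/
structure TransverselyHomogeneousFoliation where
  finiteDimensional : FiniteDimensional ℝ E
  t2 : T2Space M
  secondCountable : SecondCountableTopology M
  connected : ConnectedSpace M
  smooth_smul : ∀ γ : Γ, ContMDiff 𝓘(ℝ, E) 𝓘(ℝ, E) ∞ (fun x : M => γ • x)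
  free : ∀ (γ : Γ) (x : M), γ • x = x → γ = 1
  properlyDiscontinuous : ProperlyDiscontinuousSMul Γ M
  compact : CompactSpace (MulAction.orbitRel.Quotient Γ M)
  finiteDimensional_transverse : FiniteDimensional ℝ F
  manifold_transverse : IsManifold 𝓘(ℝ, F) ∞ N
  t2_transverse : T2Space N
  /-- The developing map. -/
  dev : M → N
  dev_smooth : ContMDiff 𝓘(ℝ, E) 𝓘(ℝ, F) ∞ dev
  dev_fibration : IsSurfaceFibration E F dev
  dev_connected : ∀ y : N, IsConnected (dev ⁻¹' {y})
  dev_equivariant : IsHomogeneousEquivariant F Γ dev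

namespace TransverselyHomogeneousFoliation

variable (𝓕 : TransverselyHomogeneousFoliation E M F N Γ)

/-- The leaf in `Γ \ M` through the image of the point `x` of `M`. -/
def leaf (x : M) : Set (MulAction.orbitRel.Quotient Γ M) :=
  (fun p : M => (Quotient.mk _ p : MulAction.orbitRel.Quotient Γ M)) '' (𝓕.dev ⁻¹' {𝓕.dev x})

/-- The foliation of `Γ \ M` is minimal: all its leaves are dense. -/
def IsMinimal : Prop := ∀ x : M, Dense (𝓕.leaf x)

end TransverselyHomogeneousFoliation

/-- The tangent vector at `φ I` which is the image under `φ` of the upward unit tangent vector of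
the upper half plane at the point `I`. -/
def frame (φ : UpperHalfPlane → M) : TangentBundle 𝓘(ℝ, E) M :=
  ⟨φ UpperHalfPlane.I, mfderiv 𝓘(ℝ, ℂ) 𝓘(ℝ, E) φ UpperHalfPlane.I Complex.I⟩

/-- The unit tangent bundle of the foliation of `M` by the fibres of `dev`, as a subspace of the
tangent bundle of `M`. -/
def UnitTangent (𝓕 : TransverselyHomogeneousFoliation E M F N Γ)
    (g : Bundle.ContMDiffRiemannianMetric 𝓘(ℝ, E) ∞ E (TangentSpace 𝓘(ℝ, E) : M → Type)) : Type :=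
  {v : TangentBundle 𝓘(ℝ, E) M //
    mfderiv 𝓘(ℝ, E) 𝓘(ℝ, F) 𝓕.dev v.1 v.2 = 0 ∧ g.inner v.1 v.2 v.2 = 1}

instance (𝓕 : TransverselyHomogeneousFoliation E M F N Γ)
    (g : Bundle.ContMDiffRiemannianMetric 𝓘(ℝ, E) ∞ E (TangentSpace 𝓘(ℝ, E) : M → Type)) :
    TopologicalSpace (UnitTangent 𝓕 g) :=
  instTopologicalSpaceSubtype

/-- `φ : ℍ → M` is smooth, takes its values in one fibre of `dev`, and is a local isometry from the
hyperbolic plane to this fibre; `ℍ` being complete, it is a Riemannian covering of the fibre. -/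
structure IsLeafUniformization (𝓕 : TransverselyHomogeneousFoliation E M F N Γ)
    (g : Bundle.ContMDiffRiemannianMetric 𝓘(ℝ, E) ∞ E (TangentSpace 𝓘(ℝ, E) : M → Type))
    (φ : UpperHalfPlane → M) : Prop where
  smooth : ContMDiff 𝓘(ℝ, ℂ) 𝓘(ℝ, E) ∞ φ
  leaf : ∀ z w, 𝓕.dev (φ z) = 𝓕.dev (φ w)
  isometric : ∀ (z : UpperHalfPlane) (w : ℂ),
    g.inner (φ z) (mfderiv 𝓘(ℝ, ℂ) 𝓘(ℝ, E) φ z w) (mfderiv 𝓘(ℝ, ℂ) 𝓘(ℝ, E) φ z w)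
      = ‖w‖ ^ 2 / z.im ^ 2

lemma IsLeafUniformization.comp_smul {𝓕 : TransverselyHomogeneousFoliation E M F N Γ}
    {g : Bundle.ContMDiffRiemannianMetric 𝓘(ℝ, E) ∞ E (TangentSpace 𝓘(ℝ, E) : M → Type)}
    {φ : UpperHalfPlane → M} (hφ : IsLeafUniformization 𝓕 g φ) (a : SL(2, ℝ)) :
    frame (E := E) (fun z => φ (a • z)) ∈ {v : TangentBundle 𝓘(ℝ, E) M |
      mfderiv 𝓘(ℝ, E) 𝓘(ℝ, F) 𝓕.dev v.1 v.2 = 0 ∧ g.inner v.1 v.2 v.2 = 1} := by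
  have hdφ : ∀ z, MDifferentiableAt 𝓘(ℝ, ℂ) 𝓘(ℝ, E) φ z := fun z =>
    (hφ.smooth z).mdifferentiableAt (by simp)
  have hda := hasMFDerivAt_smul a UpperHalfPlane.I
  have hcomp := (hdφ (a • UpperHalfPlane.I)).hasMFDerivAt.comp UpperHalfPlane.I hda
  have hm := hcomp.mfderiv
  constructor
  · have hconst : 𝓕.dev ∘ (fun z => φ (a • z)) = fun _ => 𝓕.dev (φ UpperHalfPlane.I) := by
      funext z; exact hφ.leaf _ _
    have h1 := mfderiv_comp_apply (I := 𝓘(ℝ, ℂ)) (I' := 𝓘(ℝ, E)) (I'' := 𝓘(ℝ, F))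
      (g := 𝓕.dev) (f := fun z => φ (a • z)) UpperHalfPlane.I
      ((𝓕.dev_smooth _).mdifferentiableAt (by simp)) hcomp.mdifferentiableAt Complex.I
    rw [hconst, mfderiv_const] at h1
    exact h1.symm
  · have h2 := hφ.isometric (a • UpperHalfPlane.I)
      (UpperHalfPlane.smulFDeriv (a : GL (Fin 2) ℝ) UpperHalfPlane.I Complex.I)
    rw [norm_smulFDeriv] at h2
    have h3 : mfderiv 𝓘(ℝ, ℂ) 𝓘(ℝ, E) (fun z => φ (a • z)) UpperHalfPlane.I Complex.I
      = mfderiv 𝓘(ℝ, ℂ) 𝓘(ℝ, E) φ (a • UpperHalfPlane.I)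
        (UpperHalfPlane.smulFDeriv (a : GL (Fin 2) ℝ) UpperHalfPlane.I Complex.I) := by
      have := congrArg (fun L => L Complex.I) hm
      exact this
    change g.inner (φ (a • UpperHalfPlane.I))
      (mfderiv 𝓘(ℝ, ℂ) 𝓘(ℝ, E) (fun z => φ (a • z)) UpperHalfPlane.I Complex.I)
      (mfderiv 𝓘(ℝ, ℂ) 𝓘(ℝ, E) (fun z => φ (a • z)) UpperHalfPlane.I Complex.I) = 1
    rw [h3]
    refine h2.trans ?_
    simp

/-- The vector of the unit tangent bundle reached from the base point of a uniformization by `a`. -/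
def moveFrame {𝓕 : TransverselyHomogeneousFoliation E M F N Γ}
    {g : Bundle.ContMDiffRiemannianMetric 𝓘(ℝ, E) ∞ E (TangentSpace 𝓘(ℝ, E) : M → Type)}
    {φ : UpperHalfPlane → M} (hφ : IsLeafUniformization 𝓕 g φ) (a : SL(2, ℝ)) :
    UnitTangent 𝓕 g :=
  ⟨frame (E := E) (fun z => φ (a • z)), hφ.comp_smul a⟩

/-- A hyperbolic structure on the leaves of a transversely homogeneous foliation by surfaces: a
`Γ`-invariant Riemannian metric on `M`, and for every unit vector `v` tangent to the leaves the
uniformization `unif v : ℍ → M` of the leaf of `v` (a local isometry, hence a covering, sending the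
upward unit vector at `I` to `v`). The last three conditions say that the uniformizations preserve
an orientation of the leaves which is `Γ`-invariant and continuous. -/
structure LeafwiseHyperbolicStructure (𝓕 : TransverselyHomogeneousFoliation E M F N Γ) where
  /-- The Riemannian metric on `M`. -/
  metric : Bundle.ContMDiffRiemannianMetric 𝓘(ℝ, E) ∞ E (TangentSpace 𝓘(ℝ, E) : M → Type)
  metric_invariant : ∀ (γ : Γ) (x : M) (v w : TangentSpace 𝓘(ℝ, E) x),
    metric.inner (γ • x) (mfderiv 𝓘(ℝ, E) 𝓘(ℝ, E) (fun y : M => γ • y) x v)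
      (mfderiv 𝓘(ℝ, E) 𝓘(ℝ, E) (fun y : M => γ • y) x w) = metric.inner x v w
  /-- The uniformization of the leaf of a unit vector, based at this vector. -/
  unif : UnitTangent 𝓕 metric → UpperHalfPlane → M
  isLeafUniformization : ∀ v, IsLeafUniformization 𝓕 metric (unif v)
  frame_unif : ∀ v, frame (E := E) (unif v) = v.1
  unif_move : ∀ (v : UnitTangent 𝓕 metric) (a : SL(2, ℝ)) (z : UpperHalfPlane),
    unif (moveFrame (isLeafUniformization v) a) z = unif v (a • z)
  unif_smul : ∀ (γ : Γ) (v w : UnitTangent 𝓕 metric),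
    w.1 = tangentMap 𝓘(ℝ, E) 𝓘(ℝ, E) (fun y : M => γ • y) v.1 → ∀ z, unif w z = γ • unif v z
  continuous_move : Continuous (fun p : UnitTangent 𝓕 metric × SL(2, ℝ) =>
    moveFrame (isLeafUniformization p.1) p.2)

namespace LeafwiseHyperbolicStructure

variable {𝓕 : TransverselyHomogeneousFoliation E M F N Γ} (h : LeafwiseHyperbolicStructure 𝓕)

/-- The right action of `SL(2, ℝ)` on the unit tangent bundle of the foliation of `M`: if `v` is the
image of the upward unit vector at `I` under the uniformization `φ`, then `v · a` is the image of
the upward unit vector at `I` under `φ ∘ a`. -/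
def move (v : UnitTangent 𝓕 h.metric) (a : SL(2, ℝ)) : UnitTangent 𝓕 h.metric :=
  moveFrame (h.isLeafUniformization v) a

/-- Two unit vectors tangent to the leaves are equivalent if some `γ` maps one to the other. -/
def setoid : Setoid (UnitTangent 𝓕 h.metric) where
  r v w := ∃ γ : Γ, w.1 = tangentMap 𝓘(ℝ, E) 𝓘(ℝ, E) (fun y : M => γ • y) v.1
  iseqv := by
    have hs : ∀ γ : Γ, MDifferentiable 𝓘(ℝ, E) 𝓘(ℝ, E) (fun y : M => γ • y) := fun γ =>
      (𝓕.smooth_smul γ).mdifferentiable (by simp)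
    have hmul : ∀ (γ δ : Γ) (v : TangentBundle 𝓘(ℝ, E) M),
        tangentMap 𝓘(ℝ, E) 𝓘(ℝ, E) (fun y : M => γ • y)
          (tangentMap 𝓘(ℝ, E) 𝓘(ℝ, E) (fun y : M => δ • y) v)
        = tangentMap 𝓘(ℝ, E) 𝓘(ℝ, E) (fun y : M => (γ * δ) • y) v := by
      intro γ δ v
      have := tangentMap_comp_at v (hs γ _) (hs δ v.1)
      rw [← this]
      congr 1
      funext y
      exact (mul_smul γ δ y).symm
    have hone : ∀ v : TangentBundle 𝓘(ℝ, E) M,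
        tangentMap 𝓘(ℝ, E) 𝓘(ℝ, E) (fun y : M => (1 : Γ) • y) v = v := by
      intro v
      have : (fun y : M => (1 : Γ) • y) = id := by funext y; simp
      rw [this, tangentMap_id]; rfl
    refine ⟨fun v => ⟨1, (hone _).symm⟩, ?_, ?_⟩
    · rintro v w ⟨γ, hγ⟩
      refine ⟨γ⁻¹, ?_⟩
      rw [hγ, hmul, inv_mul_cancel, hone]
    · rintro u v w ⟨γ, hγ⟩ ⟨δ, hδ⟩
      exact ⟨δ * γ, by rw [hδ, hγ, hmul]⟩

/-- The unit tangent bundle of the foliation of `Γ \ M`. -/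
def UnitTangentBundle : Type := Quotient h.setoid

instance : TopologicalSpace h.UnitTangentBundle :=
  inferInstanceAs (TopologicalSpace (Quotient h.setoid))

lemma move_congr (a : SL(2, ℝ)) (v w : UnitTangent 𝓕 h.metric) (hvw : h.setoid v w) :
    h.setoid (h.move v a) (h.move w a) := by
  obtain ⟨γ, hγ⟩ := hvw
  refine ⟨γ, ?_⟩
  have hfun : (fun z => h.unif w (a • z)) = (fun y : M => γ • y) ∘ fun z => h.unif v (a • z) := by
    funext z
    exact h.unif_smul γ v w hγ (a • z)
  have hsm : MDifferentiableAt 𝓘(ℝ, ℂ) 𝓘(ℝ, E) (fun z => h.unif v (a • z)) UpperHalfPlane.I :=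
    ((((h.isLeafUniformization v).smooth _).mdifferentiableAt (by simp)).hasMFDerivAt.comp
      UpperHalfPlane.I (hasMFDerivAt_smul a UpperHalfPlane.I)).mdifferentiableAt
  have hg : MDifferentiableAt 𝓘(ℝ, E) 𝓘(ℝ, E) (fun y : M => γ • y)
      (h.unif v (a • UpperHalfPlane.I)) := (𝓕.smooth_smul γ _).mdifferentiableAt (by simp)
  have hder := mfderiv_comp_apply (I := 𝓘(ℝ, ℂ)) (I' := 𝓘(ℝ, E)) (I'' := 𝓘(ℝ, E))
    (f := fun z => h.unif v (a • z)) UpperHalfPlane.I hg hsm Complex.I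
  change frame (E := E) (fun z => h.unif w (a • z)) = _
  rw [hfun]
  change (⟨_, _⟩ : TangentBundle 𝓘(ℝ, E) M) = ⟨_, _⟩
  rw [hder]
  rfl

lemma move_one (v : UnitTangent 𝓕 h.metric) : h.move v 1 = v := by
  apply Subtype.ext
  change frame (E := E) (fun z => h.unif v ((1 : SL(2, ℝ)) • z)) = v.1
  simpa using h.frame_unif v

lemma move_move (v : UnitTangent 𝓕 h.metric) (a b : SL(2, ℝ)) :
    h.move (h.move v a) b = h.move v (a * b) := by
  apply Subtype.ext
  change frame (E := E) (fun z => h.unif (h.move v a) (b • z))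
    = frame (E := E) (fun z => h.unif v ((a * b) • z))
  congr 1
  funext z
  rw [mul_smul]
  exact h.unif_move v a (b • z)

/-- The right action of `SL(2, ℝ)` on the unit tangent bundle of the foliation of `Γ \ M`. -/
instance : MulAction SL(2, ℝ)ᵐᵒᵖ h.UnitTangentBundle where
  smul a := Quotient.map (fun v => h.move v a.unop) (h.move_congr a.unop)
  one_smul := by
    rintro ⟨v⟩
    exact congrArg (Quotient.mk h.setoid) (h.move_one v)
  mul_smul := by
    rintro a b ⟨v⟩
    exact congrArg (Quotient.mk h.setoid) (h.move_move v b.unop a.unop).symm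

end LeafwiseHyperbolicStructure

end Foliation

/-! ### The manifold `T³_A` -/

/-- The translation `(x, t) ↦ (x + w, t)`. -/
def translation (w : Fin 2 → ℝ) : Equiv.Perm ((Fin 2 → ℝ) × ℝ) :=
  Equiv.addRight (w, 0)

/-- The affine transformation `(x, t) ↦ (A x, t + 1)`. -/
def suspension (A : SL(2, ℤ)) : Equiv.Perm ((Fin 2 → ℝ) × ℝ) :=
  (Matrix.SpecialLinearGroup.toLin' (A.map (Int.castRingHom ℝ))).toEquiv.prodCongr
    (Equiv.addRight (1 : ℝ))

/-- The group generated by the translations by the two vectors of the canonical basis of the plane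
and the suspension of `A`; the quotient of `ℝ² × ℝ` by this group is `T³_A`. -/
def groupT3 (A : SL(2, ℤ)) : Subgroup (Equiv.Perm ((Fin 2 → ℝ) × ℝ)) :=
  Subgroup.closure {translation (Pi.single 0 1), translation (Pi.single 1 1), suspension A}

/-- The determinant of two vectors of the plane. -/
def det2 (v w : Fin 2 → ℝ) : ℝ := v 0 * w 1 - v 1 * w 0

end HorocycleFoliation

end

open HorocycleFoliation

noncomputable section

namespace HorocycleFoliation

/-! On a leaf `y' = const`, put `z = x' + i l^t`. Since `d(l^t) / l^t = (log l) dt`, the leafwise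
metric is the hyperbolic metric of the upper half plane. Every element of `Γ` acts by `(z, y') ↦
(l^n z + b, l^(-n) y' + c)` (`smul_leafMap`), so it preserves the point `∞` at the boundary of every
leaf. Hence the field of unit vectors pointing to `∞` descends to `T³_A`.

In group terms, the unit tangent bundle upstairs is `PSL(2, ℝ) × ℝ`. The action is right
multiplication on the first factor (`move_unitFrame`, `unitFrame_injective`), and `Γ` multiplies on
the left by upper triangular matrices. The upward vectors form the quotient of `B × ℝ`. This set is
closed, proper and invariant under `B ⊇ U`, so neither action is minimal.

Everything else rests on two facts. The `y'`-coordinates of the integral points form a dense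
subgroup of `ℝ` (`dense_range_yCoord`). This makes all leaves dense, and also makes the upward set
minimal under `B`, because `B` is already transitive on the upward vectors of one leaf. Secondly,
the `n`-th power of the suspension contracts both `c / a`, the inverse of the endpoint `g ∞ = a / c`
of a frame, and the height `y'` by `l^(-n)`. So every nonempty closed `B`-invariant set accumulates
on an upward vector (`inter_upwardSet_nonempty`), which gives uniqueness.

Finally, `U` moves upward vectors along horocycles centred at `∞`, on which `t` is constant. Thus
`cos (2 π t)` is a nonconstant continuous `U`-invariant function on the upward set, which therefore
is not minimal for `U`. -/

/-- A basis of the plane of determinant one consisting of eigenvectors of `A` for the eigenvalues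
`l > 1` and `l⁻¹`. -/
structure Eigenbasis (A : SL(2, ℤ)) where
  l : ℝ
  u : Fin 2 → ℝ
  v : Fin 2 → ℝ
  one_lt : 1 < l
  map_u : (A.1.map (Int.cast : ℤ → ℝ)).mulVec u = l • u
  map_v : (A.1.map (Int.cast : ℤ → ℝ)).mulVec v = l⁻¹ • v
  det_eq_one : det2 u v = 1

/-! ### Eigenvectors of a hyperbolic integral matrix -/

lemma exists_eigenvector (B : Matrix (Fin 2) (Fin 2) ℝ) (r : ℝ)
    (h : r ^ 2 - B.trace * r + B.det = 0) : ∃ w : Fin 2 → ℝ, w ≠ 0 ∧ B.mulVec w = r • w := by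
  obtain ⟨w, hw, h0⟩ := (Matrix.exists_mulVec_eq_zero_iff
    (M := B - Matrix.scalar (Fin 2) r)).mpr (by
      simp only [Matrix.det_fin_two, Matrix.trace_fin_two] at h ⊢
      simp
      linarith)
  refine ⟨w, hw, ?_⟩
  rw [Matrix.sub_mulVec, sub_eq_zero] at h0
  simpa [Matrix.scalar_apply] using h0

lemma det_map_intCast (A : SL(2, ℤ)) : (A.1.map (Int.cast : ℤ → ℝ)).det = 1 := by
  have := (A.map (Int.castRingHom ℝ)).2
  simpa using this

lemma nonempty_eigenbasis (A : SL(2, ℤ)) (hA : 2 < A.1.trace) : Nonempty (Eigenbasis A) := by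
  set B : Matrix (Fin 2) (Fin 2) ℝ := A.1.map (Int.cast : ℤ → ℝ) with hB
  have hdet : B.det = 1 := det_map_intCast A
  have htr : B.trace = (A.1.trace : ℝ) := by
    simp [hB, Matrix.trace_fin_two]
  have htr2 : 2 < B.trace := by rw [htr]; exact_mod_cast hA
  set T := B.trace
  set s := Real.sqrt (T ^ 2 - 4)
  have hs : s ^ 2 = T ^ 2 - 4 := Real.sq_sqrt (by nlinarith)
  have hs0 : 0 ≤ s := Real.sqrt_nonneg _
  set l := (T + s) / 2 with hl
  have hl1 : 1 < l := by rw [hl]; linarith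
  have hl0 : l ≠ 0 := by positivity
  have hq : l ^ 2 - T * l + 1 = 0 := by rw [hl]; nlinarith
  obtain ⟨u, hu, hBu⟩ := exists_eigenvector B l (by rw [hdet]; exact hq)
  obtain ⟨v, hv, hBv⟩ := exists_eigenvector B l⁻¹ (by
    rw [hdet]; field_simp; linear_combination hq)
  -- Parallel eigenvectors would have the same eigenvalue, whereas `l⁻¹ < 1 < l`.
  have hd : det2 u v ≠ 0 := by
    intro h0
    have key : ∀ i j, u i * v j = u j * v i := by
      simp only [det2] at h0
      intro i j
      fin_cases i <;> fin_cases j <;> simp <;> linarith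
    obtain ⟨i, hi⟩ := Function.ne_iff.mp hu
    obtain ⟨j, hj⟩ := Function.ne_iff.mp hv
    simp only [Pi.zero_apply] at hi hj
    have hvi : v i ≠ 0 := by
      intro h
      have := key i j
      rw [h, mul_zero] at this
      exact mul_ne_zero hi hj this
    have hprop : v = (v i / u i) • u := by
      funext k
      have := key i k
      simp only [Pi.smul_apply, smul_eq_mul]
      field_simp
      linarith
    have h1 : B.mulVec v = l • v := by
      conv_lhs => rw [hprop, Matrix.mulVec_smul, hBu, smul_comm, ← hprop]
    have h2 := congrFun (h1.symm.trans hBv) i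
    simp only [Pi.smul_apply, smul_eq_mul] at h2
    have h3 := mul_right_cancel₀ hvi h2
    have : l⁻¹ < 1 := inv_lt_one_of_one_lt₀ hl1
    linarith
  refine ⟨⟨l, u, (det2 u v)⁻¹ • v, hl1, hBu, ?_, ?_⟩⟩
  · rw [Matrix.mulVec_smul, hBv, smul_comm]
  · have : det2 u ((det2 u v)⁻¹ • v) = (det2 u v)⁻¹ * det2 u v := by
      simp [det2]; ring
    rw [this, inv_mul_cancel₀ hd]

namespace Eigenbasis

variable {A : SL(2, ℤ)} (D : Eigenbasis A)

lemma l_pos : 0 < D.l := one_pos.trans D.one_lt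

lemma log_l_pos : 0 < Real.log D.l := Real.log_pos D.one_lt

/-! ### Coordinates -/

/-- The coordinate along `u`. -/
def xCoord : ((Fin 2 → ℝ) × ℝ) →L[ℝ] ℝ :=
  LinearMap.toContinuousLinearMap
    { toFun := fun p => det2 p.1 D.v
      map_add' := by intro p q; simp [det2]; ring
      map_smul' := by intro c p; simp [det2]; ring }

/-- The coordinate along `v`. -/
def yCoord : ((Fin 2 → ℝ) × ℝ) →L[ℝ] ℝ :=
  LinearMap.toContinuousLinearMap
    { toFun := fun p => det2 D.u p.1
      map_add' := by intro p q; simp [det2]; ring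
      map_smul' := by intro c p; simp [det2]; ring }

lemma xCoord_apply (p : (Fin 2 → ℝ) × ℝ) : D.xCoord p = det2 p.1 D.v := rfl

lemma yCoord_apply (p : (Fin 2 → ℝ) × ℝ) : D.yCoord p = det2 D.u p.1 := rfl

/-- Cramer's rule; there is no denominator because the basis has determinant one. -/
lemma smul_add_smul_eq (p : (Fin 2 → ℝ) × ℝ) :
    D.xCoord p • D.u + D.yCoord p • D.v = p.1 := by
  have h := D.det_eq_one
  rw [xCoord_apply, yCoord_apply]
  simp only [det2] at h ⊢
  funext i
  fin_cases i
  · simp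
    linear_combination (p.1 0) * h
  · simp
    linear_combination (p.1 1) * h

lemma ext_coord {p q : (Fin 2 → ℝ) × ℝ} (hx : D.xCoord p = D.xCoord q)
    (hy : D.yCoord p = D.yCoord q) (ht : p.2 = q.2) : p = q := by
  refine Prod.ext ?_ ht
  rw [← D.smul_add_smul_eq p, ← D.smul_add_smul_eq q, hx, hy]

@[simp] lemma xCoord_mk (a b t : ℝ) : D.xCoord (a • D.u + b • D.v, t) = a := by
  have h := D.det_eq_one
  simp only [xCoord_apply, det2] at h ⊢
  simp
  linear_combination a * h

@[simp] lemma yCoord_mk (a b t : ℝ) : D.yCoord (a • D.u + b • D.v, t) = b := by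
  have h := D.det_eq_one
  simp only [yCoord_apply, det2] at h ⊢
  simp
  linear_combination b * h

lemma xCoord_mk_left (a t : ℝ) : D.xCoord (a • D.u, t) = a := by
  simpa using D.xCoord_mk a 0 t

lemma yCoord_mk_left (a t : ℝ) : D.yCoord (a • D.u, t) = 0 := by
  simpa using D.yCoord_mk a 0 t

/-! ### The group -/

/-- The linear part of the elements of the group. -/
def linearPart (A : SL(2, ℤ)) (n : ℤ) :
    ((Fin 2 → ℝ) × ℝ) →L[ℝ] ((Fin 2 → ℝ) × ℝ) :=
  LinearMap.toContinuousLinearMap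
    (LinearMap.prodMap (Matrix.mulVecLin ((A ^ n).1.map (Int.cast : ℤ → ℝ))) LinearMap.id)

lemma linearPart_apply (A : SL(2, ℤ)) (n : ℤ) (p : (Fin 2 → ℝ) × ℝ) :
    linearPart A n p = (((A ^ n).1.map (Int.cast : ℤ → ℝ)).mulVec p.1, p.2) := rfl

lemma linearPart_add (A : SL(2, ℤ)) (m n : ℤ) (p : (Fin 2 → ℝ) × ℝ) :
    linearPart A (m + n) p = linearPart A m (linearPart A n p) := by
  simp only [linearPart_apply, zpow_add, Matrix.SpecialLinearGroup.coe_mul, Matrix.mulVec_mulVec]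
  have := Matrix.map_mul (L := (A ^ m).1) (M := (A ^ n).1) (f := Int.castRingHom ℝ)
  simp only [Int.coe_castRingHom] at this
  rw [this]

lemma linearPart_zero (A : SL(2, ℤ)) (p : (Fin 2 → ℝ) × ℝ) : linearPart A 0 p = p := by
  simp [linearPart_apply]

lemma coord_linearPart (n : ℤ) : ∀ p : (Fin 2 → ℝ) × ℝ,
    D.xCoord (linearPart A n p) = D.l ^ n * D.xCoord p ∧
      D.yCoord (linearPart A n p) = D.l ^ (-n) * D.yCoord p := by
  have hl := D.l_pos.ne'
  have h1 : ∀ p : (Fin 2 → ℝ) × ℝ, D.xCoord (linearPart A 1 p) = D.l * D.xCoord p ∧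
      D.yCoord (linearPart A 1 p) = D.l⁻¹ * D.yCoord p := by
    intro p
    have key : linearPart A 1 p
        = ((D.l * D.xCoord p) • D.u + (D.l⁻¹ * D.yCoord p) • D.v, p.2) := by
      rw [linearPart_apply, zpow_one]
      nth_rewrite 1 [← D.smul_add_smul_eq p]
      rw [Matrix.mulVec_add, Matrix.mulVec_smul, Matrix.mulVec_smul, D.map_u, D.map_v]
      simp only [smul_smul, mul_comm]
    rw [key]
    simp
  induction n with
  | zero => intro p; simp [linearPart_zero]
  | succ n ih =>
    intro p
    rw [linearPart_add, (ih _).1, (ih _).2, (h1 p).1, (h1 p).2, neg_add, zpow_add₀ hl,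
      zpow_add₀ hl]
    simp [mul_assoc]
  | pred n ih =>
    intro p
    have h2 := ih p
    -- The induction goes down by applying the case of exponent `1` to the image under the next
    -- lower power and cancelling the factor `l` or `l⁻¹`.
    rw [show (-(n : ℤ)) = 1 + (-(n : ℤ) - 1) by ring, linearPart_add, (h1 _).1, (h1 _).2,
      neg_add, zpow_add₀ hl, zpow_add₀ hl] at h2
    simp only [zpow_one, zpow_neg_one, mul_assoc] at h2
    exact ⟨mul_left_cancel₀ hl h2.1, mul_left_cancel₀ (inv_ne_zero hl) h2.2⟩

lemma xCoord_linearPart (n : ℤ) (p : (Fin 2 → ℝ) × ℝ) :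
    D.xCoord (linearPart A n p) = D.l ^ n * D.xCoord p := (D.coord_linearPart n p).1

lemma yCoord_linearPart (n : ℤ) (p : (Fin 2 → ℝ) × ℝ) :
    D.yCoord (linearPart A n p) = D.l ^ (-n) * D.yCoord p := (D.coord_linearPart n p).2

/-- The element of the plane with given integral coordinates, at height `0`. -/
def latticePoint (m : Fin 2 → ℤ) : (Fin 2 → ℝ) × ℝ := (fun i => (m i : ℝ), 0)

lemma linearPart_latticePoint (A : SL(2, ℤ)) (n : ℤ) (m : Fin 2 → ℤ) :
    linearPart A n (latticePoint m) = latticePoint ((A ^ n).1.mulVec m) := by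
  rw [linearPart_apply]
  refine Prod.ext ?_ rfl
  funext i
  simp [latticePoint, Matrix.mulVec, dotProduct]

lemma latticePoint_add (m n : Fin 2 → ℤ) :
    latticePoint (m + n) = latticePoint m + latticePoint n := by
  refine Prod.ext ?_ (by simp [latticePoint])
  funext i; simp [latticePoint]

lemma latticePoint_neg (m : Fin 2 → ℤ) : latticePoint (-m) = -latticePoint m := by
  refine Prod.ext ?_ (by simp [latticePoint])
  funext i; simp [latticePoint]

lemma suspension_apply (A : SL(2, ℤ)) (p : (Fin 2 → ℝ) × ℝ) :
    suspension A p = linearPart A 1 p + (0, (1 : ℝ)) := by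
  rw [linearPart_apply, zpow_one]
  refine Prod.ext ?_ rfl
  change _ = (A.1.map (Int.cast : ℤ → ℝ)).mulVec p.1 + 0
  rw [add_zero]
  rfl

/-- The affine maps of this form contain the generators and are stable under composition and
inversion, since the powers of `A` preserve the integral lattice. -/
lemma exists_apply_eq (γ : groupT3 A) : ∃ (n : ℤ) (m : Fin 2 → ℤ), ∀ p : (Fin 2 → ℝ) × ℝ,
    γ • p = linearPart A n p + latticePoint m + (0, (n : ℝ)) := by
  obtain ⟨γ, hγ⟩ := γ
  change ∃ (n : ℤ) (m : Fin 2 → ℤ), ∀ p : (Fin 2 → ℝ) × ℝ,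
    γ p = linearPart A n p + latticePoint m + (0, (n : ℝ))
  induction hγ using Subgroup.closure_induction with
  | mem x hx =>
    have htrans : ∀ i : Fin 2, ∀ p : (Fin 2 → ℝ) × ℝ, translation (Pi.single i 1) p
        = linearPart A 0 p + latticePoint (Pi.single i 1) + (0, ((0 : ℤ) : ℝ)) := by
      intro i p
      rw [linearPart_zero]
      change p + (Pi.single i 1, 0) = _
      refine Prod.ext ?_ (by simp [latticePoint])
      funext j
      by_cases h : j = i
      · subst h; simp [latticePoint]
      · simp [latticePoint, h]
    rcases hx with rfl | rfl | rfl
    · exact ⟨0, Pi.single 0 1, htrans 0⟩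
    · exact ⟨0, Pi.single 1 1, htrans 1⟩
    · refine ⟨1, 0, fun p => ?_⟩
      rw [suspension_apply]
      refine Prod.ext ?_ (by simp [latticePoint])
      funext j
      simp [latticePoint]
  | one =>
    refine ⟨0, 0, fun p => ?_⟩
    rw [linearPart_zero]
    refine Prod.ext ?_ (by simp [latticePoint])
    funext j
    simp [latticePoint]
  | mul x y _ _ hx hy =>
    obtain ⟨n, m, hx⟩ := hx
    obtain ⟨n', m', hy⟩ := hy
    refine ⟨n + n', (A ^ n).1.mulVec m' + m, fun p => ?_⟩
    have h0 : ∀ c : ℝ, linearPart A n (0, c) = (0, c) := by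
      intro c; simp [linearPart_apply]
    rw [Equiv.Perm.mul_apply, hy, hx, linearPart_add, map_add, map_add, linearPart_latticePoint,
      latticePoint_add, h0]
    refine Prod.ext ?_ ?_
    · simp only [Prod.fst_add]; abel
    · simp [latticePoint, linearPart_apply]; ring
  | inv x _ hx =>
    obtain ⟨n, m, hx⟩ := hx
    refine ⟨-n, -((A ^ (-n)).1.mulVec m), fun p => ?_⟩
    have h0 : ∀ c : ℝ, linearPart A n (0, c) = (0, c) := by
      intro c; simp [linearPart_apply]
    have h1 : linearPart A n (latticePoint (-((A ^ (-n)).1.mulVec m))) = latticePoint (-m) := by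
      rw [latticePoint_neg, map_neg, ← linearPart_latticePoint, ← linearPart_add, add_neg_cancel,
        linearPart_zero, latticePoint_neg]
    rw [Equiv.Perm.inv_eq_iff_eq, hx, map_add, map_add, ← linearPart_add, add_neg_cancel,
      linearPart_zero, h1, h0, latticePoint_neg]
    refine Prod.ext ?_ ?_
    · simp
    · simp [latticePoint]

/-- Together with `exists_suspension`, a partial converse of `exists_apply_eq`: these elements
suffice for compactness, density and contraction. -/
lemma exists_translation (A : SL(2, ℤ)) (m : Fin 2 → ℤ) :
    ∃ γ : groupT3 A, ∀ p : (Fin 2 → ℝ) × ℝ, γ • p = p + latticePoint m := by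
  have hz : ∀ (w : Fin 2 → ℝ) (k : ℤ) (p : (Fin 2 → ℝ) × ℝ),
      (translation w ^ k) p = p + ((k : ℝ) • w, 0) := by
    intro w k p
    have : translation w ^ k = Equiv.addRight (k • (w, (0 : ℝ))) := by
      simp [translation]
    rw [this]
    refine Prod.ext ?_ ?_
    · funext i; simp
    · simp
  refine ⟨⟨translation (Pi.single 0 1) ^ (m 0) * translation (Pi.single 1 1) ^ (m 1),
    Subgroup.mul_mem _ (Subgroup.zpow_mem _ (Subgroup.subset_closure (by simp)) _)
      (Subgroup.zpow_mem _ (Subgroup.subset_closure (by simp)) _)⟩, fun p => ?_⟩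
  change (translation (Pi.single 0 1) ^ (m 0) * translation (Pi.single 1 1) ^ (m 1)) p = _
  rw [Equiv.Perm.mul_apply, hz, hz]
  refine Prod.ext ?_ ?_
  · funext i
    fin_cases i <;> simp [latticePoint]
  · simp [latticePoint]

lemma exists_suspension (A : SL(2, ℤ)) (n : ℤ) :
    ∃ γ : groupT3 A, ∀ p : (Fin 2 → ℝ) × ℝ, γ • p = linearPart A n p + (0, (n : ℝ)) := by
  have hS : suspension A ∈ groupT3 A := Subgroup.subset_closure (by simp)
  have h1 := suspension_apply A
  refine ⟨⟨suspension A ^ n, Subgroup.zpow_mem _ hS n⟩, ?_⟩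
  change ∀ p, (suspension A ^ n) p = _
  induction n with
  | zero =>
    intro p
    rw [linearPart_zero]; simp
  | succ n ih =>
    intro p
    rw [zpow_add, zpow_one, Equiv.Perm.mul_apply, ih, h1, linearPart_add, map_add]
    simp [linearPart_apply]; ring
  | pred n ih =>
    intro p
    rw [sub_eq_neg_add, zpow_add, zpow_neg_one, Equiv.Perm.mul_apply, Equiv.Perm.inv_eq_iff_eq,
      ih, h1, map_add, ← linearPart_add]
    simp [linearPart_apply]; ring

/-! ### Density -/

lemma exists_yCoord_ne_zero : ∃ m : Fin 2 → ℤ, D.yCoord (latticePoint m) ≠ 0 := by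
  by_contra! h
  have h0 := h (Pi.single 0 1)
  have h1 := h (Pi.single 1 1)
  have := D.det_eq_one
  simp [yCoord_apply, det2, latticePoint] at h0 h1 this
  simp [h0, h1] at this

lemma exists_xCoord_ne_zero : ∃ m : Fin 2 → ℤ, D.xCoord (latticePoint m) ≠ 0 := by
  by_contra! h
  have h0 := h (Pi.single 0 1)
  have h1 := h (Pi.single 1 1)
  have := D.det_eq_one
  simp [xCoord_apply, det2, latticePoint] at h0 h1 this
  simp [h0, h1] at this

/-- A subgroup of `ℝ` is dense or cyclic. This one is nonzero and stable under multiplication by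
`l⁻¹`, because `A` preserves the lattice; for a cyclic group this would make `l⁻¹` an integer
strictly between `0` and `1`. -/
lemma dense_range_yCoord : DenseRange fun m : Fin 2 → ℤ => D.yCoord (latticePoint m) := by
  let H : AddSubgroup ℝ :=
    { carrier := Set.range fun m : Fin 2 → ℤ => D.yCoord (latticePoint m)
      add_mem' := by
        rintro _ _ ⟨m, rfl⟩ ⟨n, rfl⟩
        exact ⟨m + n, by simp [latticePoint_add]⟩
      zero_mem' := ⟨0, by simp [yCoord_apply, det2, latticePoint]⟩
      neg_mem' := by
        rintro _ ⟨m, rfl⟩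
        exact ⟨-m, by simp [latticePoint_neg]⟩ }
  rcases H.dense_or_cyclic with h | ⟨a, ha⟩
  · exact h
  · exfalso
    obtain ⟨m, hm⟩ := D.exists_yCoord_ne_zero
    have hmem : D.yCoord (latticePoint m) ∈ H := ⟨m, rfl⟩
    have ha0 : a ≠ 0 := by
      rintro rfl
      rw [ha] at hmem
      rw [AddSubgroup.closure_singleton_zero, AddSubgroup.mem_bot] at hmem
      exact hm hmem
    have haH : a ∈ H := by rw [ha]; exact AddSubgroup.mem_closure_singleton_self a
    obtain ⟨k, hk⟩ := haH
    have hmem2 : D.l⁻¹ * a ∈ H := by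
      refine ⟨(A ^ (1 : ℤ)).1.mulVec k, ?_⟩
      change D.yCoord _ = _
      rw [← linearPart_latticePoint, yCoord_linearPart, zpow_neg_one, ← hk]
    rw [ha, AddSubgroup.mem_closure_singleton] at hmem2
    obtain ⟨j, hj⟩ := hmem2
    rw [zsmul_eq_mul] at hj
    have hj' : (j : ℝ) = D.l⁻¹ := mul_right_cancel₀ ha0 hj
    have h1 : (0 : ℝ) < j := by rw [hj']; exact inv_pos.mpr D.l_pos
    have h2 : (j : ℝ) < 1 := by rw [hj']; exact inv_lt_one_of_one_lt₀ D.one_lt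
    have h3 : 0 < j := by exact_mod_cast h1
    have h4 : j < 1 := by exact_mod_cast h2
    omega

/-- A closed set which is invariant under integral translations and contains a fibre of the
coordinate along `v` is the whole space. -/
lemma eq_univ_of_fibre_subset {K : Set ((Fin 2 → ℝ) × ℝ)} (hK : IsClosed K) {y : ℝ}
    (hy : ∀ p, D.yCoord p = y → p ∈ K) (hinv : ∀ m : Fin 2 → ℤ, ∀ p ∈ K, p + latticePoint m ∈ K) :
    K = Set.univ := by
  refine Set.eq_univ_of_forall fun p => ?_
  have hc : Continuous fun b : ℝ => ((D.xCoord p • D.u + b • D.v, p.2) : (Fin 2 → ℝ) × ℝ) := by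
    fun_prop
  have hcl := hK.preimage hc
  have hd : Dense (Set.range fun m : Fin 2 → ℤ => y + D.yCoord (latticePoint m)) := by
    have := (Homeomorph.addLeft y).surjective.denseRange.comp D.dense_range_yCoord
      (Homeomorph.addLeft y).continuous
    exact this
  have hsub : (Set.range fun m : Fin 2 → ℤ => y + D.yCoord (latticePoint m)) ⊆
      (fun b : ℝ => ((D.xCoord p • D.u + b • D.v, p.2) : (Fin 2 → ℝ) × ℝ)) ⁻¹' K := by
    rintro _ ⟨m, rfl⟩
    -- The point to be reached, minus the lattice point, has height exactly `y`.
    have := hinv m ((D.xCoord p • D.u + (y + D.yCoord (latticePoint m)) • D.v, p.2)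
      - latticePoint m) (hy _ (by rw [map_sub, yCoord_mk]; ring))
    rwa [sub_add_cancel] at this
  have huniv := hd.closure_eq.symm.subset.trans (hcl.closure_subset_iff.mpr hsub)
  have hp := huniv (Set.mem_univ (D.yCoord p))
  simp only [Set.mem_preimage, D.smul_add_smul_eq] at hp
  exact hp

end Eigenbasis

/-! ### The affine group of the line -/

/-- The group of orientation preserving affine transformations of the line: the pair `(a, b)`
stands for the transformation `y ↦ exp a * y + b`. -/
def AffineLine : Type := ℝ × ℝ

namespace AffineLine

instance : TopologicalSpace AffineLine := inferInstanceAs (TopologicalSpace (ℝ × ℝ))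

instance : T2Space AffineLine := inferInstanceAs (T2Space (ℝ × ℝ))

instance : ConnectedSpace AffineLine := inferInstanceAs (ConnectedSpace (ℝ × ℝ))

instance : ChartedSpace (ℝ × ℝ) AffineLine := chartedSpaceSelf (ℝ × ℝ)

instance : IsManifold 𝓘(ℝ, ℝ × ℝ) ∞ AffineLine :=
  inferInstanceAs (IsManifold 𝓘(ℝ, ℝ × ℝ) ∞ (ℝ × ℝ))

/-- The transformation `y ↦ exp a * y + b`. -/
def mk (a b : ℝ) : AffineLine := ((a, b) : ℝ × ℝ)

instance : Mul AffineLine := ⟨fun g h => mk (g.1 + h.1) (Real.exp g.1 * h.2 + g.2)⟩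

instance : Inv AffineLine := ⟨fun g => mk (-g.1) (-(Real.exp (-g.1) * g.2))⟩

instance : One AffineLine := ⟨mk 0 0⟩

lemma ext_iff {g h : AffineLine} : g = h ↔ g.1 = h.1 ∧ g.2 = h.2 := Prod.ext_iff

instance : Group AffineLine :=
  Group.ofLeftAxioms
    (by
      intro a b c
      refine ext_iff.mpr ⟨add_assoc a.1 b.1 c.1, ?_⟩
      change Real.exp (a.1 + b.1) * c.2 + (Real.exp a.1 * b.2 + a.2)
        = Real.exp a.1 * (Real.exp b.1 * c.2 + b.2) + a.2
      rw [Real.exp_add]; ring)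
    (by
      intro a
      refine ext_iff.mpr ⟨zero_add a.1, ?_⟩
      change Real.exp 0 * a.2 + 0 = a.2
      simp)
    (by
      intro a
      refine ext_iff.mpr ⟨neg_add_cancel a.1, ?_⟩
      change Real.exp (-a.1) * a.2 + -(Real.exp (-a.1) * a.2) = 0
      simp)

instance : MulAction AffineLine ℝ where
  smul g y := Real.exp g.1 * y + g.2
  one_smul y := by
    change Real.exp 0 * y + 0 = y
    simp
  mul_smul g h y := by
    change Real.exp (g.1 + h.1) * y + (Real.exp g.1 * h.2 + g.2)
        = Real.exp g.1 * (Real.exp h.1 * y + h.2) + g.2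
    rw [Real.exp_add]; ring

lemma smul_def (g : AffineLine) (y : ℝ) : g • y = Real.exp g.1 * y + g.2 := rfl

instance : MulAction.IsPretransitive AffineLine ℝ where
  exists_smul_eq x y := by
    refine ⟨mk 0 (y - x), ?_⟩
    change Real.exp 0 * x + (y - x) = y
    simp

instance : LieGroup 𝓘(ℝ, ℝ × ℝ) ∞ AffineLine where
  contMDiff_mul := by
    have h : ContDiff ℝ ∞ (fun p : (ℝ × ℝ) × (ℝ × ℝ) =>
        ((p.1.1 + p.2.1, Real.exp p.1.1 * p.2.2 + p.1.2) : ℝ × ℝ)) := by fun_prop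
    have h' := h.contMDiff
    rw [modelWithCornersSelf_prod, ← chartedSpaceSelf_prod] at h'
    exact h'
  contMDiff_inv := by
    have h : ContDiff ℝ ∞ (fun p : ℝ × ℝ => ((-p.1, -(Real.exp (-p.1) * p.2)) : ℝ × ℝ)) := by
      fun_prop
    exact h.contMDiff

lemma contMDiff_smul : ContMDiff (𝓘(ℝ, ℝ × ℝ).prod 𝓘(ℝ, ℝ)) 𝓘(ℝ, ℝ) ∞
    (fun p : AffineLine × ℝ => p.1 • p.2) := by
  have h : ContDiff ℝ ∞ (fun p : (ℝ × ℝ) × ℝ => Real.exp p.1.1 * p.2 + p.1.2) := by fun_prop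
  have h' := h.contMDiff
  rw [modelWithCornersSelf_prod, ← chartedSpaceSelf_prod] at h'
  exact h'

end AffineLine

namespace Eigenbasis

variable {A : SL(2, ℤ)} (D : Eigenbasis A)

/-! ### The action of the group -/

lemma zpow_eq_exp (n : ℤ) : D.l ^ n = Real.exp (n * Real.log D.l) := by
  rw [mul_comm, Real.exp_mul, Real.exp_log D.l_pos, Real.rpow_intCast]

/-- The homomorphism from the group to the affine group of the line describing the action on the
coordinate along `v`. -/
def holonomy : groupT3 A →* AffineLine where
  -- The image of the origin determines both the exponent `n` (its last coordinate) and the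
  -- translation part, so no choice of `(n, m)` is needed. The first entry is the logarithm of
  -- `l^(-n)`.
  toFun γ := AffineLine.mk (-((γ • (0 : (Fin 2 → ℝ) × ℝ)).2 * Real.log D.l))
    (D.yCoord (γ • (0 : (Fin 2 → ℝ) × ℝ)))
  map_one' := by
    rw [one_smul, map_zero]
    refine AffineLine.ext_iff.mpr ⟨?_, rfl⟩
    change -((0 : ℝ) * _) = (0 : ℝ)
    simp
  map_mul' γ δ := by
    obtain ⟨n, m, h⟩ := exists_apply_eq γ
    have h1 : ∀ p : (Fin 2 → ℝ) × ℝ, (γ • p).2 = p.2 + n := by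
      intro p; rw [h]; simp [linearPart_apply, latticePoint]
    have h2 : ∀ p : (Fin 2 → ℝ) × ℝ, D.yCoord (γ • p)
        = D.l ^ (-n) * D.yCoord p + D.yCoord (γ • (0 : (Fin 2 → ℝ) × ℝ)) := by
      intro p; rw [h, h 0]; simp only [map_add, yCoord_linearPart]; simp; ring
    rw [mul_smul]
    refine AffineLine.ext_iff.mpr ⟨?_, ?_⟩
    · change -((γ • δ • (0 : (Fin 2 → ℝ) × ℝ)).2 * Real.log D.l)
        = -((γ • (0 : (Fin 2 → ℝ) × ℝ)).2 * Real.log D.l)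
          + -((δ • (0 : (Fin 2 → ℝ) × ℝ)).2 * Real.log D.l)
      rw [h1, h1 0]; simp; ring
    · change D.yCoord (γ • δ • (0 : (Fin 2 → ℝ) × ℝ))
        = Real.exp (-((γ • (0 : (Fin 2 → ℝ) × ℝ)).2 * Real.log D.l))
          * D.yCoord (δ • (0 : (Fin 2 → ℝ) × ℝ)) + D.yCoord (γ • (0 : (Fin 2 → ℝ) × ℝ))
      rw [h2 (δ • 0), zpow_eq_exp, h1 0]
      simp

lemma yCoord_smul (γ : groupT3 A) (p : (Fin 2 → ℝ) × ℝ) :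
    D.yCoord (γ • p) = D.holonomy γ • D.yCoord p := by
  obtain ⟨n, m, h⟩ := exists_apply_eq γ
  rw [AffineLine.smul_def]
  change _ = Real.exp (-((γ • (0 : (Fin 2 → ℝ) × ℝ)).2 * Real.log D.l)) * _
    + D.yCoord (γ • (0 : (Fin 2 → ℝ) × ℝ))
  rw [h, h 0]
  simp only [map_add, yCoord_linearPart, zpow_eq_exp]
  simp [linearPart_apply, latticePoint]
  ring

/-- Used for freeness: a fixed point forces `n = 0`, and then an affine map with trivial linear part
and a fixed point is the identity. -/
lemma smul_sub_smul (γ : groupT3 A) : ∃ n : ℤ, ∀ p q : (Fin 2 → ℝ) × ℝ,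
    (γ • p).2 = p.2 + n ∧ γ • p = γ • q + linearPart A n (p - q) := by
  obtain ⟨n, m, h⟩ := exists_apply_eq γ
  refine ⟨n, fun p q => ⟨by rw [h]; simp [linearPart_apply, latticePoint], ?_⟩⟩
  rw [h, h, map_sub]
  abel

lemma contDiff_smul (γ : groupT3 A) : ContDiff ℝ ∞ (fun p : (Fin 2 → ℝ) × ℝ => γ • p) := by
  obtain ⟨n, m, h⟩ := exists_apply_eq γ
  simp only [h]
  exact ((linearPart A n).contDiff.add contDiff_const).add contDiff_const

lemma properlyDiscontinuousSMul : ProperlyDiscontinuousSMul (groupT3 A) ((Fin 2 → ℝ) × ℝ) where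
  finite_disjoint_inter_image {K L} hK hL := by
    obtain ⟨a, ha⟩ := hK.isBounded.subset_closedBall 0
    obtain ⟨b, hb⟩ := hL.isBounded.subset_closedBall 0
    have hn2 : ∀ p : (Fin 2 → ℝ) × ℝ, |p.2| ≤ ‖p‖ := fun p => norm_snd_le p
    have hni : ∀ (p : (Fin 2 → ℝ) × ℝ) i, |p.1 i| ≤ ‖p‖ :=
      fun p i => (norm_le_pi_norm p.1 i).trans (norm_fst_le p)
    -- An element is determined by `(n, m)`. If it sends a point of norm at most `a` to one of norm
    -- at most `b`, then `|n| ≤ a + b` by looking at the last coordinate.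
    let N : ℤ := ⌈a + b⌉
    have hbdd : ∃ c : ℝ, ∀ n ∈ Finset.Icc (-N) N, ‖linearPart A n‖ ≤ c := by
      obtain ⟨c, hc⟩ := ((Finset.Icc (-N) N).finite_toSet.image
        (fun n => ‖linearPart A n‖)).bddAbove
      exact ⟨c, fun n hn => hc ⟨n, hn, rfl⟩⟩
    obtain ⟨c, hc⟩ := hbdd
    -- The lattice part is the planar part of `γ p - A^n p`, and `c` bounds the norms of the
    -- finitely many linear parts which can occur.
    let R : ℤ := ⌈b + c * a⌉
    choose f g hfg using fun γ : groupT3 A => exists_apply_eq γ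
    have hinj : Function.Injective fun γ : groupT3 A => (f γ, g γ) := by
      intro γ δ h
      simp only [Prod.mk.injEq] at h
      apply Subtype.ext
      apply Equiv.ext
      intro p
      change γ • p = δ • p
      rw [hfg γ, hfg δ, h.1, h.2]
    refine Set.Finite.of_finite_image (f := fun γ : groupT3 A => (f γ, g γ)) ?_ hinj.injOn
    refine Set.Finite.subset ((Finset.Icc (-N) N) ×ˢ
      Finset.Icc (fun _ => -R : Fin 2 → ℤ) (fun _ => R)).finite_toSet ?_
    rintro _ ⟨γ, ⟨q, ⟨p, hp, rfl⟩, hq⟩, rfl⟩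
    have hp' : ‖p‖ ≤ a := by simpa using ha hp
    have hq' : ‖γ • p‖ ≤ b := by simpa using hb hq
    have h2 : (γ • p).2 = p.2 + f γ := by
      rw [hfg]; simp [linearPart_apply, latticePoint]
    have hfN : f γ ∈ Finset.Icc (-N) N := by
      have h3 : |(f γ : ℝ)| ≤ a + b := by
        have : (f γ : ℝ) = (γ • p).2 - p.2 := by rw [h2]; ring
        rw [this]
        have := abs_sub (γ • p).2 p.2
        have := hn2 p
        have := hn2 (γ • p)
        linarith
      have h4 : |f γ| ≤ N := by
        have : ((|f γ| : ℤ) : ℝ) ≤ N := by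
          push_cast; exact h3.trans (Int.le_ceil _)
        exact_mod_cast this
      rw [abs_le] at h4
      exact Finset.mem_Icc.mpr h4
    have hgR : ∀ i, |g γ i| ≤ R := by
      intro i
      have h5 : (g γ i : ℝ) = (γ • p).1 i - (linearPart A (f γ) p).1 i := by
        rw [hfg]; simp [latticePoint]
      have h6 : ‖linearPart A (f γ) p‖ ≤ c * a :=
        ((linearPart A (f γ)).le_opNorm p).trans
          (mul_le_mul (hc _ hfN) hp' (norm_nonneg _) ((norm_nonneg _).trans (hc _ hfN)))
      have : ((|g γ i| : ℤ) : ℝ) ≤ R := by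
        push_cast
        refine le_trans ?_ (Int.le_ceil _)
        rw [h5]
        have := abs_sub ((γ • p).1 i) ((linearPart A (f γ) p).1 i)
        have := hni (γ • p) i
        have := hni (linearPart A (f γ) p) i
        linarith
      exact_mod_cast this
    simp only [Finset.coe_product, Set.mem_prod, Finset.mem_coe]
    refine ⟨hfN, Finset.mem_Icc.mpr
      ⟨fun i => (abs_le.mp (hgR i)).1, fun i => (abs_le.mp (hgR i)).2⟩⟩

lemma compactSpace_quotient (A : SL(2, ℤ)) :
    CompactSpace (MulAction.orbitRel.Quotient (groupT3 A) ((Fin 2 → ℝ) × ℝ)) := by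
  let C : Set ((Fin 2 → ℝ) × ℝ) := Set.Icc 0 1 ×ˢ Set.Icc 0 1
  have hC : IsCompact C := isCompact_Icc.prod isCompact_Icc
  let π : (Fin 2 → ℝ) × ℝ → MulAction.orbitRel.Quotient (groupT3 A) ((Fin 2 → ℝ) × ℝ) :=
    fun p => Quotient.mk _ p
  have hπ : Continuous π := continuous_quotient_mk'
  refine ⟨?_⟩
  have : π '' C = Set.univ := by
    refine Set.eq_univ_of_forall ?_
    rintro ⟨p⟩
    -- The height is normalized first, because the suspension changes the planar part while
    -- translations do not change the height.
    obtain ⟨γ, hγ⟩ := exists_suspension A (-⌊p.2⌋)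
    obtain ⟨δ, hδ⟩ := exists_translation A (fun i => -⌊(γ • p).1 i⌋)
    refine ⟨δ • γ • p, ⟨⟨fun i => ?_, fun i => ?_⟩, ?_, ?_⟩, ?_⟩
    · rw [hδ]
      simp only [Prod.fst_add, Pi.add_apply, latticePoint, Pi.zero_apply]
      push_cast
      linarith [Int.floor_le ((γ • p).1 i)]
    · rw [hδ]
      simp only [Prod.fst_add, Pi.add_apply, latticePoint, Pi.one_apply]
      push_cast
      linarith [Int.lt_floor_add_one ((γ • p).1 i)]
    · rw [hδ, hγ]
      simp [latticePoint, linearPart_apply]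
      linarith [Int.floor_le p.2]
    · rw [hδ, hγ]
      simp [latticePoint, linearPart_apply]
      linarith [Int.lt_floor_add_one p.2]
    · refine Quotient.sound ?_
      rw [← mul_smul]
      exact ⟨δ * γ, rfl⟩
  rw [← this]
  exact hC.image hπ

/-! ### The foliation -/

/-- The coordinates as a linear isomorphism to a product of a line and a Euclidean plane. -/
def coordEquiv : ((Fin 2 → ℝ) × ℝ) ≃L[ℝ] ℝ × EuclideanSpace ℝ (Fin 2) :=
  LinearEquiv.toContinuousLinearEquiv
    { toFun := fun p => (D.yCoord p, !₂[D.xCoord p, p.2])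
      map_add' := by
        intro p q
        refine Prod.ext (by simp) ?_
        ext i; fin_cases i <;> simp
      map_smul' := by
        intro c p
        refine Prod.ext (by simp) ?_
        ext i; fin_cases i <;> simp
      invFun := fun q => (q.2 0 • D.u + q.1 • D.v, q.2 1)
      left_inv := by
        intro p
        simp [D.smul_add_smul_eq]
      right_inv := by
        intro q
        refine Prod.ext (by simp) ?_
        ext i; fin_cases i <;> simp }

lemma coordEquiv_fst (p : (Fin 2 → ℝ) × ℝ) : (D.coordEquiv p).1 = D.yCoord p := rfl

/-- The linear coordinates trivialize the fibration globally, so one trivialization over the whole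
line serves every point. -/
lemma isSurfaceFibration : IsSurfaceFibration ((Fin 2 → ℝ) × ℝ) ℝ (M := (Fin 2 → ℝ) × ℝ) (N := ℝ)
    (fun p => D.yCoord p) := by
  intro y
  refine ⟨EuclideanSpace ℝ (Fin 2), inferInstance, inferInstance, inferInstance, Set.univ,
    D.coordEquiv.toHomeomorph.toOpenPartialHomeomorph, isOpen_univ, Set.mem_univ _, ?_, ?_,
    fun x _ => D.coordEquiv_fst x, ?_, ?_⟩
  · simp
  · simp
  · have h := D.coordEquiv.contDiff (n := ∞)
    have h' := h.contMDiff.contMDiffOn (s := Set.univ)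
    rw [modelWithCornersSelf_prod (E := ℝ) (F := EuclideanSpace ℝ (Fin 2)),
      ← chartedSpaceSelf_prod (H := ℝ) (H' := EuclideanSpace ℝ (Fin 2))] at h'
    exact h'
  · have h := D.coordEquiv.symm.contDiff (n := ∞)
    have h' := h.contMDiff.contMDiffOn (s := Set.univ)
    rw [modelWithCornersSelf_prod (E := ℝ) (F := EuclideanSpace ℝ (Fin 2)),
      ← chartedSpaceSelf_prod (H := ℝ) (H' := EuclideanSpace ℝ (Fin 2))] at h'
    simpa using! h'

lemma isConnected_fibre (y : ℝ) : IsConnected ((fun p => D.yCoord p) ⁻¹' {y}) := by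
  have hc : Convex ℝ ((fun p => D.yCoord p) ⁻¹' {y}) :=
    (convex_singleton y).linear_preimage D.yCoord.toLinearMap
  exact ⟨⟨(y • D.v, 0), by simpa using D.yCoord_mk 0 y 0⟩, hc.isPreconnected⟩

/-- The foliation of `T³_A` by the fibres of the coordinate along `v`. -/
def foliation : TransverselyHomogeneousFoliation
    ((Fin 2 → ℝ) × ℝ) ((Fin 2 → ℝ) × ℝ) ℝ ℝ (groupT3 A) where
  finiteDimensional := inferInstance
  t2 := inferInstance
  secondCountable := inferInstance
  connected := inferInstance
  smooth_smul γ := (contDiff_smul γ).contMDiff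
  free γ p h := by
    obtain ⟨n, hn⟩ := smul_sub_smul γ
    have h0 : n = 0 := by
      have := (hn p 0).1
      rw [h] at this
      exact_mod_cast (left_eq_add.mp this)
    apply Subtype.ext
    apply Equiv.ext
    intro q
    change γ • q = q
    rw [(hn q p).2, h, h0, linearPart_zero]
    abel
  properlyDiscontinuous := properlyDiscontinuousSMul
  compact := compactSpace_quotient A
  finiteDimensional_transverse := inferInstance
  manifold_transverse := inferInstance
  t2_transverse := inferInstance
  dev p := D.yCoord p
  dev_smooth := D.yCoord.contDiff.contMDiff
  dev_fibration := D.isSurfaceFibration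
  dev_connected := D.isConnected_fibre
  dev_equivariant :=
    ⟨ℝ × ℝ, inferInstance, inferInstance, inferInstance, AffineLine, inferInstance, inferInstance,
      inferInstance, inferInstance, inferInstance, inferInstance, inferInstance, D.holonomy,
      inferInstance, AffineLine.contMDiff_smul, D.yCoord_smul⟩

lemma foliation_dev (p : (Fin 2 → ℝ) × ℝ) : D.foliation.dev p = D.yCoord p := rfl

/-- The preimage upstairs of the closure of a leaf is closed, contains a fibre and is invariant
under integral translations; `eq_univ_of_fibre_subset` applies. -/
lemma foliation_isMinimal : D.foliation.IsMinimal := by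
  intro x
  let π : (Fin 2 → ℝ) × ℝ → MulAction.orbitRel.Quotient (groupT3 A) ((Fin 2 → ℝ) × ℝ) :=
    fun p => Quotient.mk _ p
  have hπ : Continuous π := continuous_quotient_mk'
  have h : π ⁻¹' closure (D.foliation.leaf x) = Set.univ := by
    refine D.eq_univ_of_fibre_subset (isClosed_closure.preimage hπ) (y := D.yCoord x) ?_ ?_
    · intro p hp
      exact subset_closure ⟨p, hp, rfl⟩
    · intro m p hp
      obtain ⟨γ, hγ⟩ := exists_translation A m
      have : π (p + latticePoint m) = π p := Quotient.sound ⟨γ, hγ p⟩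
      rw [Set.mem_preimage, this]
      exact hp
  rintro ⟨p⟩
  have := h.symm.subset (Set.mem_univ p)
  exact this

end Eigenbasis

/-! ### Riemannian metrics on a vector space -/

section VectorSpace

variable {V : Type} [NormedAddCommGroup V] [NormedSpace ℝ V]

lemma contDiff_smul_add_smul_add {f g : V → ℝ} (hf : ContDiff ℝ ∞ f) (hg : ContDiff ℝ ∞ g)
    {W : Type} [NormedAddCommGroup W] [NormedSpace ℝ W] (a b c : W) :
    ContDiff ℝ ∞ fun p => f p • a + g p • b + c :=
  ((hf.smul contDiff_const).add (hg.smul contDiff_const)).add contDiff_const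

lemma symmL_trivializationAt_apply (x b v : V) :
    (trivializationAt V (TangentSpace 𝓘(ℝ, V)) x).symmL ℝ b v = v := by
  rw [TangentBundle.symmL_model_space]; rfl

lemma trivializationAt_dual_apply (x b w : V) (φ : TangentSpace 𝓘(ℝ, V) b →L[ℝ] ℝ) :
    (trivializationAt (V →L[ℝ] ℝ)
      (fun x : V => TangentSpace 𝓘(ℝ, V) x →L[ℝ] ℝ) x).continuousLinearMapAt ℝ b φ w = φ w := by
  have h : (trivializationAt ℝ (Bundle.Trivial V ℝ) x).continuousLinearMapAt ℝ b
      (φ ((trivializationAt V (TangentSpace 𝓘(ℝ, V)) x).symmL ℝ b w)) = φ w := by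
    rw [symmL_trivializationAt_apply, Bundle.Trivialization.continuousLinearMapAt_apply,
      Bundle.Trivialization.linearMapAt_apply]
    simp
  rw [Bundle.Trivialization.continuousLinearMapAt_apply, Bundle.Trivialization.linearMapAt_apply,
    if_pos (by simp only [hom_trivializationAt_baseSet]; exact ⟨Set.mem_univ b, Set.mem_univ b⟩)]
  exact h

lemma trivializationAt_form_apply (x b v w : V)
    (φ : TangentSpace 𝓘(ℝ, V) b →L[ℝ] TangentSpace 𝓘(ℝ, V) b →L[ℝ] ℝ) :
    (trivializationAt (V →L[ℝ] V →L[ℝ] ℝ)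
      (fun x : V => TangentSpace 𝓘(ℝ, V) x →L[ℝ] TangentSpace 𝓘(ℝ, V) x →L[ℝ] ℝ) x ⟨b, φ⟩).2 v w
      = φ v w := by
  have h : (trivializationAt (V →L[ℝ] ℝ)
      (fun x : V => TangentSpace 𝓘(ℝ, V) x →L[ℝ] ℝ) x).continuousLinearMapAt ℝ b
      (φ ((trivializationAt V (TangentSpace 𝓘(ℝ, V)) x).symmL ℝ b v)) w = φ v w := by
    rw [symmL_trivializationAt_apply]
    exact trivializationAt_dual_apply x b w (φ v)
  exact h

/-- The trivializations of the bundle of bilinear forms act as the identity over a vector space, so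
smoothness of a section is ordinary smoothness of a map. -/
lemma contMDiff_form
    (B : ∀ b : V, TangentSpace 𝓘(ℝ, V) b →L[ℝ] TangentSpace 𝓘(ℝ, V) b →L[ℝ] ℝ)
    (hB : ContDiff ℝ ∞ (show V → V →L[ℝ] V →L[ℝ] ℝ from B)) :
    ContMDiff 𝓘(ℝ, V) (𝓘(ℝ, V).prod 𝓘(ℝ, V →L[ℝ] V →L[ℝ] ℝ)) ∞
      (fun b => Bundle.TotalSpace.mk' (V →L[ℝ] V →L[ℝ] ℝ)
        (E := fun b : V => TangentSpace 𝓘(ℝ, V) b →L[ℝ] TangentSpace 𝓘(ℝ, V) b →L[ℝ] ℝ)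
        b (B b)) := by
  intro x
  rw [Bundle.contMDiffAt_section]
  refine hB.contMDiff.contMDiffAt.congr_of_eventuallyEq (Filter.Eventually.of_forall fun b => ?_)
  exact ContinuousLinearMap.ext fun v => ContinuousLinearMap.ext fun w =>
    trivializationAt_form_apply x b v w (B b)

/-- The Riemannian metric on a vector space given by a smooth family of bilinear forms. -/
def riemannianMetricOfForm (B : V → V →L[ℝ] V →L[ℝ] ℝ) (hB : ContDiff ℝ ∞ B)
    (symm : ∀ p v w, B p v w = B p w v) (pos : ∀ p v, v ≠ 0 → 0 < B p v v)
    (bdd : ∀ p, Bornology.IsVonNBounded ℝ {v : V | B p v v < 1}) :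
    Bundle.ContMDiffRiemannianMetric 𝓘(ℝ, V) ∞ V (TangentSpace 𝓘(ℝ, V) : V → Type) where
  inner p := B p
  symm := symm
  pos := pos
  isVonNBounded := bdd
  contMDiff := contMDiff_form (fun b => B b) hB

end VectorSpace

namespace Eigenbasis

variable {A : SL(2, ℤ)} (D : Eigenbasis A)

/-! ### The metric -/

/-- The third coordinate. -/
def tCoord : ((Fin 2 → ℝ) × ℝ) →L[ℝ] ℝ := ContinuousLinearMap.snd ℝ (Fin 2 → ℝ) ℝ

lemma tCoord_apply (p : (Fin 2 → ℝ) × ℝ) : tCoord p = p.2 := rfl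

/-- The invariant metric, in coordinates
`l ^ (-2 t) (dx')² + l ^ (2 t) (dy')² + (log l)² (dt)²`. -/
def metricForm (p : (Fin 2 → ℝ) × ℝ) :
    ((Fin 2 → ℝ) × ℝ) →L[ℝ] ((Fin 2 → ℝ) × ℝ) →L[ℝ] ℝ :=
  ((D.l ^ p.2)⁻¹ ^ 2) • D.xCoord.smulRight D.xCoord
    + ((D.l ^ p.2) ^ 2) • D.yCoord.smulRight D.yCoord
    + (Real.log D.l ^ 2) • tCoord.smulRight tCoord

lemma metricForm_apply (p v w : (Fin 2 → ℝ) × ℝ) : D.metricForm p v w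
    = (D.l ^ p.2)⁻¹ ^ 2 * (D.xCoord v * D.xCoord w) + (D.l ^ p.2) ^ 2 * (D.yCoord v * D.yCoord w)
      + Real.log D.l ^ 2 * (v.2 * w.2) := by
  simp [metricForm, tCoord_apply]

lemma metricForm_self (p v : (Fin 2 → ℝ) × ℝ) : D.metricForm p v v
    = (D.xCoord v / D.l ^ p.2) ^ 2 + (D.yCoord v * D.l ^ p.2) ^ 2 + (Real.log D.l * v.2) ^ 2 := by
  rw [metricForm_apply]; ring

lemma rpow_pos (t : ℝ) : 0 < D.l ^ t := Real.rpow_pos_of_pos D.l_pos t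

lemma contDiff_metricForm : ContDiff ℝ ∞ D.metricForm := by
  have h : ContDiff ℝ ∞ fun p : (Fin 2 → ℝ) × ℝ => D.l ^ p.2 :=
    contDiff_const.rpow contDiff_snd fun _ => D.l_pos.ne'
  have h' : ContDiff ℝ ∞ fun p : (Fin 2 → ℝ) × ℝ => (D.l ^ p.2)⁻¹ :=
    h.inv fun p => (D.rpow_pos p.2).ne'
  exact contDiff_smul_add_smul_add (h'.pow 2) (h.pow 2) _ _ _

/-- Each of the three squares is at most one, which bounds each coordinate. This gives the
boundedness of unit balls required of a Riemannian metric. -/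
lemma norm_le_of_metricForm_lt (p v : (Fin 2 → ℝ) × ℝ) (h : D.metricForm p v v < 1) :
    ‖v‖ ≤ (D.l ^ p.2 * ‖D.u‖ + (D.l ^ p.2)⁻¹ * ‖D.v‖) + (Real.log D.l)⁻¹ := by
  have hr := D.rpow_pos p.2
  have hlog := D.log_l_pos
  rw [metricForm_self] at h
  have hx : |D.xCoord v| ≤ D.l ^ p.2 := by
    have : |D.xCoord v / D.l ^ p.2| ≤ 1 := abs_le_one_iff_mul_self_le_one.mpr (by
      nlinarith [sq_nonneg (D.yCoord v * D.l ^ p.2), sq_nonneg (Real.log D.l * v.2)])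
    rwa [abs_div, abs_of_pos hr, div_le_one hr] at this
  have hy : |D.yCoord v| ≤ (D.l ^ p.2)⁻¹ := by
    have : |D.yCoord v * D.l ^ p.2| ≤ 1 := abs_le_one_iff_mul_self_le_one.mpr (by
      nlinarith [sq_nonneg (D.xCoord v / D.l ^ p.2), sq_nonneg (Real.log D.l * v.2)])
    rw [abs_mul, abs_of_pos hr] at this
    rwa [← one_div, le_div_iff₀ hr]
  have ht : |v.2| ≤ (Real.log D.l)⁻¹ := by
    have : |Real.log D.l * v.2| ≤ 1 := abs_le_one_iff_mul_self_le_one.mpr (by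
      nlinarith [sq_nonneg (D.xCoord v / D.l ^ p.2), sq_nonneg (D.yCoord v * D.l ^ p.2)])
    rw [abs_mul, abs_of_pos hlog, mul_comm] at this
    rwa [← one_div, le_div_iff₀ hlog]
  have h1 : ‖v.1‖ ≤ D.l ^ p.2 * ‖D.u‖ + (D.l ^ p.2)⁻¹ * ‖D.v‖ := by
    rw [← D.smul_add_smul_eq v]
    refine (norm_add_le _ _).trans ?_
    rw [norm_smul, norm_smul]
    exact add_le_add (mul_le_mul_of_nonneg_right hx (norm_nonneg _))
      (mul_le_mul_of_nonneg_right hy (norm_nonneg _))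
  refine max_le (h1.trans (le_add_of_nonneg_right (inv_pos.mpr hlog).le)) ?_
  refine le_trans (show ‖v.2‖ ≤ _ from ht) (le_add_of_nonneg_left ?_)
  positivity

lemma metricForm_pos (p v : (Fin 2 → ℝ) × ℝ) (hv : v ≠ 0) : 0 < D.metricForm p v v := by
  have hr := (D.rpow_pos p.2).ne'
  rw [metricForm_self]
  have h1 := sq_nonneg (D.xCoord v / D.l ^ p.2)
  have h2 := sq_nonneg (D.yCoord v * D.l ^ p.2)
  have h3 := sq_nonneg (Real.log D.l * v.2)
  by_contra! h
  have hx : D.xCoord v / D.l ^ p.2 = 0 := (pow_eq_zero_iff two_ne_zero).mp (by linarith)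
  have hy : D.yCoord v * D.l ^ p.2 = 0 := (pow_eq_zero_iff two_ne_zero).mp (by linarith)
  have ht : Real.log D.l * v.2 = 0 := (pow_eq_zero_iff two_ne_zero).mp (by linarith)
  apply hv
  refine D.ext_coord (q := 0) ?_ ?_ ?_
  · simpa [hr] using hx
  · simpa [hr] using hy
  · simpa [D.log_l_pos.ne'] using ht

/-- The invariant Riemannian metric on `ℝ² × ℝ`. -/
def metric : Bundle.ContMDiffRiemannianMetric 𝓘(ℝ, (Fin 2 → ℝ) × ℝ) ∞ ((Fin 2 → ℝ) × ℝ)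
    (TangentSpace 𝓘(ℝ, (Fin 2 → ℝ) × ℝ) : (Fin 2 → ℝ) × ℝ → Type) :=
  riemannianMetricOfForm D.metricForm D.contDiff_metricForm
    (fun p v w => by rw [metricForm_apply, metricForm_apply]; ring) D.metricForm_pos
    (fun p => (NormedSpace.isVonNBounded_closedBall ℝ ((Fin 2 → ℝ) × ℝ) _).subset fun v hv =>
      mem_closedBall_zero_iff.mpr (D.norm_le_of_metricForm_lt p v hv))

lemma mfderiv_smul (γ : groupT3 A) : ∃ n : ℤ, (∀ p : (Fin 2 → ℝ) × ℝ, (γ • p).2 = p.2 + n) ∧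
    ∀ p v : (Fin 2 → ℝ) × ℝ, mfderiv 𝓘(ℝ, (Fin 2 → ℝ) × ℝ) 𝓘(ℝ, (Fin 2 → ℝ) × ℝ)
      (fun q : (Fin 2 → ℝ) × ℝ => γ • q) p v = linearPart A n v := by
  obtain ⟨n, m, h⟩ := exists_apply_eq γ
  refine ⟨n, fun p => by rw [h]; simp [linearPart_apply, latticePoint], fun p v => ?_⟩
  rw [mfderiv_eq_fderiv]
  have : HasFDerivAt (fun q : (Fin 2 → ℝ) × ℝ => γ • q) (linearPart A n) p := by
    simp only [h]
    exact ((linearPart A n).hasFDerivAt.add_const _).add_const _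
  rw [this.fderiv]
  rfl

/-- The linear part multiplies `x'` by `l^n` and `y'` by `l^(-n)`; the shift of `t` by `n` changes
the weights `l^(-2t)` and `l^(2t)` by the inverse squares of these factors. -/
lemma metricForm_smul (n : ℤ) (p q v w : (Fin 2 → ℝ) × ℝ) (h : q.2 = p.2 + n) :
    D.metricForm q (linearPart A n v) (linearPart A n w) = D.metricForm p v w := by
  have hr := (D.rpow_pos p.2).ne'
  have hl := (zpow_pos D.l_pos n).ne'
  simp only [metricForm_apply, xCoord_linearPart, yCoord_linearPart]
  rw [h, Real.rpow_add D.l_pos, Real.rpow_intCast, zpow_neg]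
  simp only [linearPart_apply]
  field_simp

lemma mem_unitTangent_iff (v : TangentBundle 𝓘(ℝ, (Fin 2 → ℝ) × ℝ) ((Fin 2 → ℝ) × ℝ)) :
    (mfderiv 𝓘(ℝ, (Fin 2 → ℝ) × ℝ) 𝓘(ℝ, ℝ) D.foliation.dev v.1 v.2 = 0
      ∧ D.metric.inner v.1 v.2 v.2 = 1) ↔ D.yCoord v.2 = 0 ∧ D.metricForm v.1 v.2 v.2 = 1 := by
  have h : D.foliation.dev = D.yCoord := rfl
  rw [h, mfderiv_eq_fderiv, ContinuousLinearMap.fderiv]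
  rfl

end Eigenbasis

/-! ### The upper half plane as a real manifold -/

lemma contMDiff_coe_real : ContMDiff 𝓘(ℝ, ℂ) 𝓘(ℝ, ℂ) ∞ ((↑) : UpperHalfPlane → ℂ) := by
  have : IsManifold 𝓘(ℝ, ℂ) ∞ UpperHalfPlane :=
    UpperHalfPlane.isOpenEmbedding_coe.isManifold_singleton
  exact fun _ => contMDiffAt_extChartAt

lemma hasMFDerivAt_coe (z : UpperHalfPlane) :
    HasMFDerivAt 𝓘(ℝ, ℂ) 𝓘(ℝ, ℂ) ((↑) : UpperHalfPlane → ℂ) z (ContinuousLinearMap.id ℝ ℂ) := by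
  refine ⟨UpperHalfPlane.continuous_coe.continuousAt, ?_⟩
  have h : HasFDerivAt (fun w : ℂ => ((UpperHalfPlane.ofComplex w : UpperHalfPlane) : ℂ))
      (ContinuousLinearMap.id ℝ ℂ) (z : ℂ) :=
    (hasFDerivAt_id (𝕜 := ℝ) (z : ℂ)).congr_of_eventuallyEq
      (UpperHalfPlane.eventuallyEq_coe_comp_ofComplex z.im_pos)
  exact h.hasFDerivWithinAt

lemma smulFDeriv_apply (g : SL(2, ℝ)) (z : UpperHalfPlane) (w : ℂ) :
    UpperHalfPlane.smulFDeriv (g : GL (Fin 2) ℝ) z w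
      = w / ((g 1 0 : ℂ) * z + (g 1 1 : ℂ)) ^ 2 := by
  simp [UpperHalfPlane.smulFDeriv, UpperHalfPlane.σ, UpperHalfPlane.denom, div_eq_mul_inv]

lemma coe_smul_eq (g : SL(2, ℝ)) (z : UpperHalfPlane) : ((g • z : UpperHalfPlane) : ℂ)
    = ((g 0 0 : ℂ) * z + (g 0 1 : ℂ)) / ((g 1 0 : ℂ) * z + (g 1 1 : ℂ)) :=
  UpperHalfPlane.coe_specialLinearGroup_apply g z

lemma neg_smul_upperHalfPlane (g : SL(2, ℝ)) (z : UpperHalfPlane) : (-g) • z = g • z := by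
  apply UpperHalfPlane.ext
  rw [coe_smul_eq, coe_smul_eq, ← neg_div_neg_eq]
  simp
  ring

/-! ### Recovering a matrix, up to sign, from its action on the upward vector at `I` -/

lemma det_SL2 (g : SL(2, ℝ)) : g 0 0 * g 1 1 - g 0 1 * g 1 0 = 1 := by
  have := g.2
  rwa [Matrix.det_fin_two] at this

/-- The sum of the squares of the entries of the second row. -/
def rowNormSq (g : SL(2, ℝ)) : ℝ := g 1 0 ^ 2 + g 1 1 ^ 2

lemma rowNormSq_pos (g : SL(2, ℝ)) : 0 < rowNormSq g := by
  have h := det_SL2 g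
  by_contra! h0
  unfold rowNormSq at h0
  have hc : g 1 0 = 0 := by nlinarith [sq_nonneg (g 1 0), sq_nonneg (g 1 1)]
  have hd : g 1 1 = 0 := by nlinarith [sq_nonneg (g 1 0), sq_nonneg (g 1 1)]
  rw [hc, hd] at h
  simp at h

/-- The scalar product of the two rows. -/
def rowInner (g : SL(2, ℝ)) : ℝ := g 0 0 * g 1 0 + g 0 1 * g 1 1

lemma denom_I_ne_zero (g : SL(2, ℝ)) : (g 1 0 : ℂ) * Complex.I + (g 1 1 : ℂ) ≠ 0 := by
  intro h
  have hr := congrArg Complex.re h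
  have hi := congrArg Complex.im h
  simp at hr hi
  have := rowNormSq_pos g
  simp [rowNormSq, hr, hi] at this

lemma coe_smul_I (g : SL(2, ℝ)) : ((g • UpperHalfPlane.I : UpperHalfPlane) : ℂ)
    = ⟨rowInner g / rowNormSq g, 1 / rowNormSq g⟩ := by
  have hN := (rowNormSq_pos g).ne'
  have h := det_SL2 g
  rw [coe_smul_eq, UpperHalfPlane.coe_I, div_eq_iff (denom_I_ne_zero g)]
  apply Complex.ext
  · simp only [Complex.add_re, Complex.mul_re, Complex.ofReal_re, Complex.ofReal_im, Complex.I_re,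
      Complex.I_im, Complex.add_im, Complex.mul_im]
    field_simp
    simp only [rowInner, rowNormSq]
    linear_combination (-g 1 0) * h
  · simp only [Complex.add_re, Complex.mul_re, Complex.ofReal_re, Complex.ofReal_im, Complex.I_re,
      Complex.I_im, Complex.add_im, Complex.mul_im]
    field_simp
    simp only [rowInner, rowNormSq]
    linear_combination (g 1 1) * h

lemma I_div_denom_sq (g : SL(2, ℝ)) :
    Complex.I / ((g 1 0 : ℂ) * Complex.I + (g 1 1 : ℂ)) ^ 2
    = ⟨2 * (g 1 0 * g 1 1) / rowNormSq g ^ 2, (g 1 1 ^ 2 - g 1 0 ^ 2) / rowNormSq g ^ 2⟩ := by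
  have hN := (rowNormSq_pos g).ne'
  rw [div_eq_iff (pow_ne_zero 2 (denom_I_ne_zero g))]
  apply Complex.ext
  · simp only [pow_two, Complex.add_re, Complex.mul_re, Complex.ofReal_re, Complex.ofReal_im,
      Complex.I_re, Complex.I_im, Complex.add_im, Complex.mul_im]
    field_simp
    ring
  · simp only [pow_two, Complex.add_re, Complex.mul_re, Complex.ofReal_re, Complex.ofReal_im,
      Complex.I_re, Complex.I_im, Complex.add_im, Complex.mul_im]
    field_simp
    simp only [rowNormSq]
    ring

/-- For the bottom row `(c, d)`, the values of `c² + d²` and `d² - c²` give `c` and `d` up to signs,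
and `c d` fixes the relative sign. The determinant and the scalar product of the rows then determine
the top row. -/
lemma eq_or_eq_neg_of_row {g h : SL(2, ℝ)} (hN : rowNormSq g = rowNormSq h)
    (hi : rowInner g = rowInner h) (h1 : g 1 0 * g 1 1 = h 1 0 * h 1 1)
    (h2 : g 1 1 ^ 2 - g 1 0 ^ 2 = h 1 1 ^ 2 - h 1 0 ^ 2) : g = h ∨ g = -h := by
  have hN0 := (rowNormSq_pos h).ne'
  have hg := det_SL2 g
  have hh := det_SL2 h
  have ea : g 0 0 * rowNormSq g = g 1 1 + rowInner g * g 1 0 := by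
    simp only [rowNormSq, rowInner]; linear_combination g 1 1 * hg
  have eb : g 0 1 * rowNormSq g = -g 1 0 + rowInner g * g 1 1 := by
    simp only [rowNormSq, rowInner]; linear_combination (-g 1 0) * hg
  have ea' : h 0 0 * rowNormSq h = h 1 1 + rowInner h * h 1 0 := by
    simp only [rowNormSq, rowInner]; linear_combination h 1 1 * hh
  have eb' : h 0 1 * rowNormSq h = -h 1 0 + rowInner h * h 1 1 := by
    simp only [rowNormSq, rowInner]; linear_combination (-h 1 0) * hh
  rw [hN, hi] at ea eb
  have hc2 : g 1 0 ^ 2 = h 1 0 ^ 2 := by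
    simp only [rowNormSq] at hN; linarith
  have hd2 : g 1 1 ^ 2 = h 1 1 ^ 2 := by
    simp only [rowNormSq] at hN; linarith
  have hcase : (g 1 0 = h 1 0 ∧ g 1 1 = h 1 1) ∨ (g 1 0 = -h 1 0 ∧ g 1 1 = -h 1 1) := by
    rcases sq_eq_sq_iff_eq_or_eq_neg.mp hc2 with hc | hc <;>
    rcases sq_eq_sq_iff_eq_or_eq_neg.mp hd2 with hd | hd
    · exact Or.inl ⟨hc, hd⟩
    · rw [hc, hd] at h1
      have h0 : h 1 0 * h 1 1 = 0 := by linarith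
      rcases mul_eq_zero.mp h0 with h0 | h0
      · exact Or.inr ⟨by rw [hc, h0, neg_zero], hd⟩
      · exact Or.inl ⟨hc, by rw [hd, h0, neg_zero]⟩
    · rw [hc, hd] at h1
      have h0 : h 1 0 * h 1 1 = 0 := by linarith
      rcases mul_eq_zero.mp h0 with h0 | h0
      · exact Or.inl ⟨by rw [hc, h0, neg_zero], hd⟩
      · exact Or.inr ⟨hc, by rw [hd, h0, neg_zero]⟩
    · exact Or.inr ⟨hc, hd⟩
  rcases hcase with ⟨hc, hd⟩ | ⟨hc, hd⟩
  · left
    rw [hc, hd] at ea eb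
    have ha := mul_right_cancel₀ hN0 (ea.trans ea'.symm)
    have hb := mul_right_cancel₀ hN0 (eb.trans eb'.symm)
    ext i j
    fin_cases i <;> fin_cases j <;> assumption
  · right
    rw [hc, hd] at ea eb
    have ha : g 0 0 = -h 0 0 := mul_right_cancel₀ hN0 (by linarith)
    have hb : g 0 1 = -h 0 1 := mul_right_cancel₀ hN0 (by linarith)
    ext i j
    rw [Matrix.SpecialLinearGroup.coe_neg, Matrix.neg_apply]
    fin_cases i <;> fin_cases j <;> assumption

/-- With `ζ² = α + i β`, the bottom row is `√N (Im ζ, Re ζ)`: doubling the angle turns `ζ` into the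
required `d² - c²` and `2 c d`. The top row is `(d, -c) / N + x (c, d)`, the first term giving
determinant one and the second the prescribed scalar product. -/
lemma exists_row {x N α β : ℝ} (hN : 0 < N) (h : α ^ 2 + β ^ 2 = 1) : ∃ g : SL(2, ℝ),
    rowNormSq g = N ∧ rowInner g = x * N ∧ 2 * (g 1 0 * g 1 1) = β * N ∧
      g 1 1 ^ 2 - g 1 0 ^ 2 = α * N := by
  obtain ⟨ζ, hζ⟩ := IsAlgClosed.exists_pow_nat_eq (⟨α, β⟩ : ℂ) two_pos
  have hre := congrArg Complex.re hζ
  have him := congrArg Complex.im hζ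
  simp only [pow_two, Complex.mul_re, Complex.mul_im] at hre him
  have h1 : ζ.re ^ 2 + ζ.im ^ 2 = 1 := by
    have : (ζ.re ^ 2 + ζ.im ^ 2) ^ 2 = 1 := by rw [← h, ← hre, ← him]; ring
    nlinarith [sq_nonneg ζ.re, sq_nonneg ζ.im]
  obtain ⟨s, hs, hs2⟩ : ∃ s : ℝ, 0 < s ∧ s ^ 2 = N :=
    ⟨Real.sqrt N, Real.sqrt_pos.mpr hN, Real.sq_sqrt hN.le⟩
  have hd : (!![ζ.re * s / N + x * (ζ.im * s), -(ζ.im * s) / N + x * (ζ.re * s);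
      ζ.im * s, ζ.re * s] : Matrix (Fin 2) (Fin 2) ℝ).det = 1 := by
    rw [Matrix.det_fin_two_of]
    field_simp
    linear_combination s ^ 2 * h1 + hs2
  have hNe : (ζ.im * s) ^ 2 + (ζ.re * s) ^ 2 = N := by linear_combination s ^ 2 * h1 + hs2
  refine ⟨⟨_, hd⟩, ?_, ?_, ?_, ?_⟩
  · simpa [rowNormSq] using hNe
  · simp only [rowInner, Matrix.of_apply, Matrix.cons_val_zero, Matrix.cons_val_one,
      Matrix.cons_val', Matrix.cons_val_fin_one]
    linear_combination x * hNe
  · simp only [Matrix.of_apply, Matrix.cons_val_zero, Matrix.cons_val_one,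
      Matrix.cons_val', Matrix.cons_val_fin_one]
    linear_combination s ^ 2 * him + β * hs2
  · simp only [Matrix.of_apply, Matrix.cons_val_zero, Matrix.cons_val_one,
      Matrix.cons_val', Matrix.cons_val_fin_one]
    linear_combination s ^ 2 * hre + α * hs2

namespace Eigenbasis

variable {A : SL(2, ℤ)} (D : Eigenbasis A)

/-! ### Uniformization of the leaves -/

/-- The point of the leaf of height `y` with complex coordinate `z = x' + i l ^ t`. -/
def planePoint (y : ℝ) (z : ℂ) : (Fin 2 → ℝ) × ℝ :=
  (z.re • D.u + y • D.v, Real.log z.im / Real.log D.l)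

/-- The derivative of the coordinates of a leaf. -/
def planeDeriv (z : ℂ) : ℂ →L[ℝ] (Fin 2 → ℝ) × ℝ :=
  (Complex.reCLM.smulRight D.u).prod ((z.im * Real.log D.l)⁻¹ • Complex.imCLM)

lemma planeDeriv_apply (z w : ℂ) :
    D.planeDeriv z w = (w.re • D.u, w.im / (z.im * Real.log D.l)) := by
  simp [planeDeriv, div_eq_inv_mul]

lemma hasFDerivAt_planePoint (y : ℝ) {z : ℂ} (hz : 0 < z.im) :
    HasFDerivAt (D.planePoint y) (D.planeDeriv z) z := by
  refine HasFDerivAt.prodMk ?_ ?_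
  · exact ((Complex.reCLM.hasFDerivAt (x := z)).smul_const D.u).add_const (y • D.v)
  · have h := ((Complex.imCLM.hasFDerivAt (x := z)).log hz.ne').mul_const (Real.log D.l)⁻¹
    refine h.congr_fderiv ?_
    ext w
    simp
    ring

lemma contDiffAt_planePoint (y : ℝ) {z : ℂ} (hz : 0 < z.im) :
    ContDiffAt ℝ ∞ (D.planePoint y) z := by
  refine ContDiffAt.prodMk ?_ ?_
  · exact (Complex.reCLM.contDiff.contDiffAt.smul contDiffAt_const).add contDiffAt_const
  · exact (Complex.imCLM.contDiff.contDiffAt.log hz.ne').div_const _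

/-- The uniformization of the leaf of height `y` given by an element of `SL(2, ℝ)`. -/
def leafMap (g : SL(2, ℝ)) (y : ℝ) (z : UpperHalfPlane) : (Fin 2 → ℝ) × ℝ :=
  D.planePoint y ((g • z : UpperHalfPlane) : ℂ)

lemma leafMap_smul (g a : SL(2, ℝ)) (y : ℝ) (z : UpperHalfPlane) :
    D.leafMap g y (a • z) = D.leafMap (g * a) y z := by
  simp only [leafMap, mul_smul]

lemma hasMFDerivAt_leafMap (g : SL(2, ℝ)) (y : ℝ) (z : UpperHalfPlane) :
    HasMFDerivAt 𝓘(ℝ, ℂ) 𝓘(ℝ, (Fin 2 → ℝ) × ℝ) (D.leafMap g y) z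
      ((D.planeDeriv ((g • z : UpperHalfPlane) : ℂ)).comp
        (UpperHalfPlane.smulFDeriv (g : GL (Fin 2) ℝ) z)) := by
  have h1 := hasMFDerivAt_smul g z
  have h2 := (hasMFDerivAt_coe (g • z)).comp z h1
  have h3 := (D.hasFDerivAt_planePoint y (g • z).im_pos).hasMFDerivAt.comp z h2
  exact h3

lemma contMDiff_leafMap (g : SL(2, ℝ)) (y : ℝ) :
    ContMDiff 𝓘(ℝ, ℂ) 𝓘(ℝ, (Fin 2 → ℝ) × ℝ) ∞ (D.leafMap g y) := by
  intro z
  have hne : (g 1 0 : ℂ) * z + (g 1 1 : ℂ) ≠ 0 :=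
    UpperHalfPlane.denom_ne_zero (g : GL (Fin 2) ℝ) z
  have h1 : ContDiffAt ℝ ∞ (fun w : ℂ => ((g 0 0 : ℂ) * w + (g 0 1 : ℂ))
      / ((g 1 0 : ℂ) * w + (g 1 1 : ℂ))) (z : ℂ) := by
    have hlin : ∀ a b : ℂ, ContDiffAt ℂ ∞ (fun w : ℂ => a * w + b) (z : ℂ) := fun a b =>
      (contDiffAt_const.mul contDiffAt_id).add contDiffAt_const
    exact ((hlin _ _).div (hlin _ _) hne).restrict_scalars ℝ
  have h2 : ContDiffAt ℝ ∞ (D.planePoint y) (((g 0 0 : ℂ) * z + (g 0 1 : ℂ))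
      / ((g 1 0 : ℂ) * z + (g 1 1 : ℂ))) := by
    rw [← coe_smul_eq]
    exact D.contDiffAt_planePoint y (g • z).im_pos
  have h3 := (h2.comp (z : ℂ) h1).contMDiffAt.comp z (contMDiff_coe_real z)
  refine h3.congr_of_eventuallyEq (Filter.Eventually.of_forall fun w => ?_)
  simp only [leafMap, coe_smul_eq, Function.comp_apply]

lemma rpow_log_div (r : ℝ) (hr : 0 < r) : D.l ^ (Real.log r / Real.log D.l) = r := by
  rw [Real.rpow_def_of_pos D.l_pos, mul_div_cancel₀ _ D.log_l_pos.ne', Real.exp_log hr]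

/-- Since `Im z = l^t`, the term `(log l)² dt²` is `(d Im z)² / (Im z)²` and the weight of `dx'²` is
`1 / (Im z)²`: this is the hyperbolic metric. -/
lemma metricForm_planePoint (y : ℝ) {z : ℂ} (hz : 0 < z.im) (w : ℂ) :
    D.metricForm (D.planePoint y z) (D.planeDeriv z w) (D.planeDeriv z w)
      = ‖w‖ ^ 2 / z.im ^ 2 := by
  have hl := D.log_l_pos.ne'
  rw [metricForm_self, planeDeriv_apply, xCoord_mk_left, yCoord_mk_left, planePoint,
    rpow_log_div D _ hz, ← Complex.normSq_eq_norm_sq, Complex.normSq_apply]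
  field_simp
  ring

lemma isLeafUniformization_leafMap (g : SL(2, ℝ)) (y : ℝ) :
    IsLeafUniformization D.foliation D.metric (D.leafMap g y) where
  smooth := D.contMDiff_leafMap g y
  leaf z w := by
    simp [foliation_dev, leafMap, planePoint]
  isometric z w := by
    rw [(D.hasMFDerivAt_leafMap g y z).mfderiv]
    refine (D.metricForm_planePoint y (g • z).im_pos
      (UpperHalfPlane.smulFDeriv (g : GL (Fin 2) ℝ) z w)).trans ?_
    exact norm_smulFDeriv g z w

/-- The coordinates of a frame. -/
def frameVector (g : SL(2, ℝ)) (y : ℝ) : ((Fin 2 → ℝ) × ℝ) × ((Fin 2 → ℝ) × ℝ) :=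
  (((rowInner g / rowNormSq g) • D.u + y • D.v, -Real.log (rowNormSq g) / Real.log D.l),
    ((2 * (g 1 0 * g 1 1) / rowNormSq g ^ 2) • D.u,
      (g 1 1 ^ 2 - g 1 0 ^ 2) / (rowNormSq g * Real.log D.l)))

lemma frame_leafMap (g : SL(2, ℝ)) (y : ℝ) :
    frame (E := (Fin 2 → ℝ) × ℝ) (D.leafMap g y)
      = ⟨(D.frameVector g y).1, (D.frameVector g y).2⟩ := by
  have hN := (rowNormSq_pos g).ne'
  have hl := D.log_l_pos.ne'
  have h1 : D.leafMap g y UpperHalfPlane.I = (D.frameVector g y).1 := by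
    simp only [leafMap, coe_smul_I, planePoint, frameVector, one_div, Real.log_inv]
  have h2 : mfderiv 𝓘(ℝ, ℂ) 𝓘(ℝ, (Fin 2 → ℝ) × ℝ) (D.leafMap g y) UpperHalfPlane.I Complex.I
      = (D.frameVector g y).2 := by
    rw [(D.hasMFDerivAt_leafMap g y _).mfderiv]
    change D.planeDeriv _ (UpperHalfPlane.smulFDeriv (g : GL (Fin 2) ℝ)
      (UpperHalfPlane.I : ℂ) Complex.I) = _
    rw [smulFDeriv_apply, UpperHalfPlane.coe_I, I_div_denom_sq, coe_smul_I, planeDeriv_apply]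
    refine Prod.ext rfl ?_
    simp only [frameVector]
    field_simp
  unfold frame
  rw [h2]
  congr 1

/-- The unit vector which is the image of the upward vector at the point `I` under the
uniformization given by an element of `SL(2, ℝ)`. -/
def unitFrame (g : SL(2, ℝ)) (y : ℝ) : UnitTangent D.foliation D.metric :=
  ⟨frame (E := (Fin 2 → ℝ) × ℝ) (D.leafMap g y), by
    simpa using (D.isLeafUniformization_leafMap g y).comp_smul 1⟩

lemma unitFrame_val (g : SL(2, ℝ)) (y : ℝ) : (D.unitFrame g y).1
    = ⟨(D.frameVector g y).1, (D.frameVector g y).2⟩ := D.frame_leafMap g y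

lemma moveFrame_leafMap (g a : SL(2, ℝ)) (y : ℝ) :
    moveFrame (D.isLeafUniformization_leafMap g y) a = D.unitFrame (g * a) y := by
  apply Subtype.ext
  simp only [moveFrame, unitFrame, leafMap_smul]

lemma exists_frameVector_eq (p w : (Fin 2 → ℝ) × ℝ) (hy : D.yCoord w = 0)
    (hm : D.metricForm p w w = 1) : ∃ g y, D.frameVector g y = (p, w) := by
  have hr := D.rpow_pos p.2
  have hl := D.log_l_pos.ne'
  rw [metricForm_self, hy, zero_mul] at hm
  -- The image of `I` has imaginary part `1 / N`, which must be `l^t`; hence `N = l^(-t)`. The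
  -- numbers `α` and `β` are the vertical and horizontal components of the vector in the hyperbolic
  -- metric, so `α² + β² = 1` is the unit length condition.
  obtain ⟨g, hN, hi, h1, h2⟩ := exists_row (x := D.xCoord p) (N := (D.l ^ p.2)⁻¹)
    (α := Real.log D.l * w.2) (β := D.xCoord w / D.l ^ p.2) (inv_pos.mpr hr) (by linarith)
  refine ⟨g, D.yCoord p, Prod.ext (Prod.ext ?_ ?_) (D.ext_coord ?_ ?_ ?_)⟩
  · simp only [frameVector]
    rw [hN, hi, mul_div_cancel_right₀ _ (inv_ne_zero hr.ne'), D.smul_add_smul_eq]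
  · simp only [frameVector]
    rw [hN, Real.log_inv, neg_neg, Real.log_rpow D.l_pos]
    field_simp
  · simp only [frameVector, xCoord_mk_left]
    rw [hN, h1]
    field_simp
  · simp only [frameVector, yCoord_mk_left]
    exact hy.symm
  · simp only [frameVector]
    rw [hN, h2]
    field_simp

lemma exists_unitFrame_eq (v : UnitTangent D.foliation D.metric) :
    ∃ g y, D.unitFrame g y = v := by
  obtain ⟨⟨p, w⟩, hv⟩ := v
  have h := (D.mem_unitTangent_iff ⟨p, w⟩).mp hv
  obtain ⟨g, y, hgy⟩ := D.exists_frameVector_eq p w h.1 h.2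
  refine ⟨g, y, Subtype.ext ?_⟩
  rw [unitFrame_val, hgy]

/-- With `exists_unitFrame_eq`, this identifies the unit tangent bundle upstairs with `PSL(2, ℝ) ×
ℝ`. -/
lemma unitFrame_injective {g h : SL(2, ℝ)} {y y' : ℝ} (heq : D.unitFrame g y = D.unitFrame h y') :
    y = y' ∧ (g = h ∨ g = -h) := by
  have heq' := congrArg Subtype.val heq
  rw [unitFrame_val, unitFrame_val] at heq'
  have hl := D.log_l_pos.ne'
  have hN := rowNormSq_pos g
  have hN' := rowNormSq_pos h
  have hp : (D.frameVector g y).1 = (D.frameVector h y').1 :=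
    congrArg (fun q : TangentBundle 𝓘(ℝ, (Fin 2 → ℝ) × ℝ) ((Fin 2 → ℝ) × ℝ) => q.1) heq'
  have hw : (D.frameVector g y).2 = (D.frameVector h y').2 :=
    congrArg (fun q : TangentBundle 𝓘(ℝ, (Fin 2 → ℝ) × ℝ) ((Fin 2 → ℝ) × ℝ) =>
      (q.2 : (Fin 2 → ℝ) × ℝ)) heq'
  have hx := congrArg D.xCoord hp
  have hy := congrArg D.yCoord hp
  have ht := congrArg Prod.snd hp
  have hwx := congrArg D.xCoord hw
  have hwt := congrArg Prod.snd hw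
  simp only [frameVector, xCoord_mk, yCoord_mk, xCoord_mk_left] at hx hy ht hwx hwt
  have hNN : rowNormSq g = rowNormSq h := by
    apply Real.log_injOn_pos hN hN'
    field_simp at ht
    linarith
  rw [hNN] at hx hwx hwt
  field_simp at hx hwx hwt
  refine ⟨hy, eq_or_eq_neg_of_row hNN hx (by linarith) hwt⟩

/-- The matrix of a unit vector is only defined up to sign, but `-1` acts trivially on the half
plane. Thus the uniformization depends only on the vector, whichever representative is chosen. -/
lemma leafMap_eq_of_unitFrame_eq {g h : SL(2, ℝ)} {y y' : ℝ}
    (heq : D.unitFrame g y = D.unitFrame h y') : D.leafMap g y = D.leafMap h y' := by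
  obtain ⟨rfl, rfl | rfl⟩ := D.unitFrame_injective heq
  · rfl
  · funext z
    simp only [leafMap, neg_smul_upperHalfPlane]

end Eigenbasis

/-- The matrix of the Möbius transformation `z ↦ s² z + b`. -/
def affineSL2 (s b : ℝ) (hs : s ≠ 0) : SL(2, ℝ) :=
  ⟨!![s, b / s; 0, s⁻¹], by rw [Matrix.det_fin_two_of]; field_simp; simp⟩

lemma coe_affineSL2_smul (s b : ℝ) (hs : s ≠ 0) (z : UpperHalfPlane) :
    ((affineSL2 s b hs • z : UpperHalfPlane) : ℂ) = (s ^ 2 : ℝ) * z + b := by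
  have : (s : ℂ) ≠ 0 := by exact_mod_cast hs
  rw [coe_smul_eq]
  simp [affineSL2]
  field_simp

lemma affineSL2_mul_row (s b : ℝ) (hs : s ≠ 0) (g : SL(2, ℝ)) :
    (affineSL2 s b hs * g) 0 0 = s * g 0 0 + b / s * g 1 0 ∧
    (affineSL2 s b hs * g) 1 0 = s⁻¹ * g 1 0 := by
  rw [Matrix.SpecialLinearGroup.coe_mul]
  simp [affineSL2, Matrix.mul_apply, Fin.sum_univ_two]

namespace Eigenbasis

variable {A : SL(2, ℤ)} (D : Eigenbasis A)

/-! ### The action of the group on the frames -/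

/-- Shifting `t` by `n` multiplies `Im z = l^t` by `l^n`, the same factor by which `A^n` multiplies
`x'`. So the group acts between leaves by `z ↦ l^n z + b`, that is, through left multiplication by
an upper triangular matrix; `s` is a square root of `l^n` because the matrix dilates by `s²`. -/
lemma smul_leafMap {γ : groupT3 A} {n : ℤ} {q : (Fin 2 → ℝ) × ℝ}
    (hγ : ∀ p : (Fin 2 → ℝ) × ℝ, γ • p = linearPart A n p + q) (hq : q.2 = n)
    {s : ℝ} (hs : s ≠ 0) (hsn : s ^ 2 = D.l ^ n) (g : SL(2, ℝ)) (y : ℝ) :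
    (fun z => γ • D.leafMap g y z)
      = D.leafMap (affineSL2 s (D.xCoord q) hs * g) (D.l ^ (-n) * y + D.yCoord q) := by
  funext z
  have hl := D.log_l_pos.ne'
  have hz : 0 < ((g • z : UpperHalfPlane) : ℂ).im := (g • z).im_pos
  simp only [leafMap, mul_smul]
  rw [coe_affineSL2_smul, hγ]
  refine D.ext_coord ?_ ?_ ?_
  · rw [map_add, xCoord_linearPart]
    simp only [planePoint, xCoord_mk]
    rw [hsn]
    simp only [Complex.add_re, Complex.mul_re, Complex.ofReal_re, Complex.ofReal_im, zero_mul,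
      sub_zero]
  · rw [map_add, yCoord_linearPart]
    simp only [planePoint, yCoord_mk]
  · simp only [planePoint, Prod.snd_add, linearPart_apply]
    rw [hsn, hq]
    simp only [Complex.add_im, Complex.mul_im, Complex.ofReal_re, Complex.ofReal_im, zero_mul,
      add_zero]
    rw [Real.log_mul (zpow_pos D.l_pos n).ne' hz.ne', Real.log_zpow]
    field_simp
    ring

lemma exists_sq_eq_zpow (n : ℤ) : ∃ s : ℝ, 0 < s ∧ s ^ 2 = D.l ^ n :=
  ⟨Real.sqrt (D.l ^ n), Real.sqrt_pos.mpr (zpow_pos D.l_pos n),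
    Real.sq_sqrt (zpow_pos D.l_pos n).le⟩

lemma tangentMap_unitFrame {γ : groupT3 A} {g g' : SL(2, ℝ)} {y y' : ℝ}
    (h : (fun z => γ • D.leafMap g y z) = D.leafMap g' y') :
    (D.unitFrame g' y').1 = tangentMap 𝓘(ℝ, (Fin 2 → ℝ) × ℝ) 𝓘(ℝ, (Fin 2 → ℝ) × ℝ)
      (fun p : (Fin 2 → ℝ) × ℝ => γ • p) (D.unitFrame g y).1 := by
  have hg : MDifferentiableAt 𝓘(ℝ, (Fin 2 → ℝ) × ℝ) 𝓘(ℝ, (Fin 2 → ℝ) × ℝ)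
      (fun p : (Fin 2 → ℝ) × ℝ => γ • p) (D.leafMap g y UpperHalfPlane.I) :=
    (D.foliation.smooth_smul γ _).mdifferentiableAt (by simp)
  have hder := mfderiv_comp_apply (I := 𝓘(ℝ, ℂ)) (I' := 𝓘(ℝ, (Fin 2 → ℝ) × ℝ))
    (I'' := 𝓘(ℝ, (Fin 2 → ℝ) × ℝ)) (f := D.leafMap g y) UpperHalfPlane.I hg
    (D.hasMFDerivAt_leafMap g y _).mdifferentiableAt Complex.I
  change frame (E := (Fin 2 → ℝ) × ℝ) (D.leafMap g' y') = _
  rw [← h]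
  change (⟨_, mfderiv _ _ ((fun p : (Fin 2 → ℝ) × ℝ => γ • p) ∘ D.leafMap g y) _ _⟩ :
    TangentBundle 𝓘(ℝ, (Fin 2 → ℝ) × ℝ) ((Fin 2 → ℝ) × ℝ)) = ⟨_, _⟩
  rw [hder]
  rfl

/-! ### The topology of the unit tangent bundle -/

/-- The coordinates of a unit vector. -/
def toVector (v : UnitTangent D.foliation D.metric) : ((Fin 2 → ℝ) × ℝ) × ((Fin 2 → ℝ) × ℝ) :=
  (v.1.1, v.1.2)

lemma toVector_unitFrame (g : SL(2, ℝ)) (y : ℝ) :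
    D.toVector (D.unitFrame g y) = D.frameVector g y := by
  simp only [toVector]
  rw [unitFrame_val]

lemma isInducing_toVector : Topology.IsInducing D.toVector :=
  (tangentBundleModelSpaceHomeomorph 𝓘(ℝ, (Fin 2 → ℝ) × ℝ)).isInducing.comp
    Topology.IsInducing.subtypeVal

lemma continuous_toVector : Continuous D.toVector := D.isInducing_toVector.continuous

/-- Only expressions unchanged under `g ↦ -g` are required to be continuous. This allows `g` itself
to jump between signs, as the chosen representative `matrixOf` may do. -/
lemma continuous_unitFrame_comp {X : Type} [TopologicalSpace X] {g : X → SL(2, ℝ)} {y : X → ℝ}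
    (hN : Continuous fun x => rowNormSq (g x)) (hi : Continuous fun x => rowInner (g x))
    (h1 : Continuous fun x => g x 1 0 * g x 1 1)
    (h2 : Continuous fun x => g x 1 1 ^ 2 - g x 1 0 ^ 2) (hy : Continuous y) :
    Continuous fun x => D.unitFrame (g x) (y x) := by
  rw [D.isInducing_toVector.continuous_iff]
  have hne : ∀ x, rowNormSq (g x) ≠ 0 := fun x => (rowNormSq_pos (g x)).ne'
  have hne2 : ∀ x, rowNormSq (g x) ^ 2 ≠ 0 := fun x => pow_ne_zero 2 (hne x)
  have hne3 : ∀ x, rowNormSq (g x) * Real.log D.l ≠ 0 :=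
    fun x => mul_ne_zero (hne x) D.log_l_pos.ne'
  have : D.toVector ∘ (fun x => D.unitFrame (g x) (y x)) = fun x => D.frameVector (g x) (y x) :=
    funext fun x => D.toVector_unitFrame _ _
  rw [this]
  refine ((((hi.div hN hne).smul continuous_const).add (hy.smul continuous_const)).prodMk
    (((hN.log hne).neg).div_const _)).prodMk (Continuous.prodMk ?_ ?_)
  · exact ((continuous_const.mul h1).div (hN.pow 2) hne2).smul continuous_const
  · exact h2.div (hN.mul continuous_const) hne3

lemma continuous_entry (i j : Fin 2) : Continuous fun a : SL(2, ℝ) => a i j :=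
  continuous_subtype_val.matrix_elem i j

lemma continuous_unitFrame : Continuous fun q : SL(2, ℝ) × ℝ => D.unitFrame q.1 q.2 := by
  have h : ∀ i j, Continuous fun q : SL(2, ℝ) × ℝ => q.1 i j :=
    fun i j => (continuous_entry i j).comp continuous_fst
  refine D.continuous_unitFrame_comp ?_ ?_ ?_ ?_ continuous_snd
  · exact ((h 1 0).pow 2).add ((h 1 1).pow 2)
  · exact ((h 0 0).mul (h 1 0)).add ((h 0 1).mul (h 1 1))
  · exact (h 1 0).mul (h 1 1)
  · exact ((h 1 1).pow 2).sub ((h 1 0).pow 2)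

/-! ### The leafwise hyperbolic structure -/

/-- An element of `SL(2, ℝ)` defining a unit vector. -/
def matrixOf (v : UnitTangent D.foliation D.metric) : SL(2, ℝ) := (D.exists_unitFrame_eq v).choose

/-- The height of the leaf of a unit vector. -/
def heightOf (v : UnitTangent D.foliation D.metric) : ℝ :=
  (D.exists_unitFrame_eq v).choose_spec.choose

lemma unitFrame_matrixOf (v : UnitTangent D.foliation D.metric) :
    D.unitFrame (D.matrixOf v) (D.heightOf v) = v :=
  (D.exists_unitFrame_eq v).choose_spec.choose_spec

lemma frameVector_matrixOf (v : UnitTangent D.foliation D.metric) :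
    D.frameVector (D.matrixOf v) (D.heightOf v) = D.toVector v := by
  rw [← toVector_unitFrame, unitFrame_matrixOf]

lemma continuous_heightOf : Continuous D.heightOf := by
  have h : Continuous fun v => D.yCoord (D.toVector v).1 :=
    D.yCoord.continuous.comp (continuous_fst.comp D.continuous_toVector)
  refine h.congr fun v => ?_
  rw [← frameVector_matrixOf]
  simp only [frameVector, yCoord_mk]

lemma continuous_rowNormSq_matrixOf : Continuous fun v => rowNormSq (D.matrixOf v) := by
  have h : Continuous fun v => Real.exp (-((D.toVector v).1.2 * Real.log D.l)) :=
    (((continuous_snd.comp (continuous_fst.comp D.continuous_toVector)).mul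
      continuous_const).neg).rexp
  refine h.congr fun v => ?_
  have hl := D.log_l_pos.ne'
  rw [← frameVector_matrixOf]
  simp only [frameVector]
  rw [div_mul_cancel₀ _ hl, neg_neg, Real.exp_log (rowNormSq_pos _)]

lemma continuous_rowInner_matrixOf : Continuous fun v => rowInner (D.matrixOf v) := by
  have h : Continuous fun v => D.xCoord (D.toVector v).1 * rowNormSq (D.matrixOf v) :=
    (D.xCoord.continuous.comp (continuous_fst.comp D.continuous_toVector)).mul
      D.continuous_rowNormSq_matrixOf
  refine h.congr fun v => ?_
  rw [← frameVector_matrixOf]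
  simp only [frameVector, xCoord_mk]
  rw [div_mul_cancel₀ _ (rowNormSq_pos _).ne']

lemma continuous_row_mul_matrixOf :
    Continuous fun v => D.matrixOf v 1 0 * D.matrixOf v 1 1 := by
  have h : Continuous fun v => D.xCoord (D.toVector v).2 * rowNormSq (D.matrixOf v) ^ 2 / 2 :=
    ((D.xCoord.continuous.comp (continuous_snd.comp D.continuous_toVector)).mul
      (D.continuous_rowNormSq_matrixOf.pow 2)).div_const 2
  refine h.congr fun v => ?_
  rw [← frameVector_matrixOf]
  simp only [frameVector, xCoord_mk_left]
  rw [div_mul_cancel₀ _ (pow_ne_zero 2 (rowNormSq_pos _).ne')]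
  ring

lemma continuous_row_sub_matrixOf :
    Continuous fun v => D.matrixOf v 1 1 ^ 2 - D.matrixOf v 1 0 ^ 2 := by
  have h : Continuous fun v => (D.toVector v).2.2 * (rowNormSq (D.matrixOf v) * Real.log D.l) :=
    (continuous_snd.comp (continuous_snd.comp D.continuous_toVector)).mul
      (D.continuous_rowNormSq_matrixOf.mul continuous_const)
  refine h.congr fun v => ?_
  rw [← frameVector_matrixOf]
  simp only [frameVector]
  rw [div_mul_cancel₀ _ (mul_ne_zero (rowNormSq_pos _).ne' D.log_l_pos.ne')]

/-- The quadratic monomials `c²`, `d²`, `c d`, `a c`, `b d` and the sum `a d + b c` in the entries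
of the representative are insensitive to its sign and continuous. The quantities needed for the
product matrix are polynomials in these and in the entries of the second factor. -/
lemma continuous_unitFrame_matrixOf_mul :
    Continuous fun q : UnitTangent D.foliation D.metric × SL(2, ℝ) =>
      D.unitFrame (D.matrixOf q.1 * q.2) (D.heightOf q.1) := by
  have hN := D.continuous_rowNormSq_matrixOf
  have hi := D.continuous_rowInner_matrixOf
  have hcd := D.continuous_row_mul_matrixOf
  have he := D.continuous_row_sub_matrixOf
  have hne : ∀ v, rowNormSq (D.matrixOf v) ≠ 0 := fun v => (rowNormSq_pos _).ne'
  have hc2 : Continuous fun v => D.matrixOf v 1 0 ^ 2 := by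
    refine ((hN.sub he).div_const 2).congr fun v => ?_
    simp only [rowNormSq, Pi.sub_apply]; ring
  have hd2 : Continuous fun v => D.matrixOf v 1 1 ^ 2 := by
    refine ((hN.add he).div_const 2).congr fun v => ?_
    simp only [rowNormSq, Pi.add_apply]; ring
  -- This and the next two quotients come from `a N = d + r c` and `b N = -c + r d`, where `N` is
  -- `rowNormSq` and `r` is `rowInner`; both are consequences of the determinant being one.
  have hac : Continuous fun v => D.matrixOf v 0 0 * D.matrixOf v 1 0 := by
    refine ((hcd.add (hi.mul hc2)).div hN hne).congr fun v => ?_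
    simp only [Pi.add_apply, Pi.mul_apply, Pi.div_apply]
    rw [div_eq_iff (hne v)]
    simp only [rowNormSq, rowInner]
    linear_combination (-D.matrixOf v 1 0 * D.matrixOf v 1 1) * det_SL2 (D.matrixOf v)
  have hbd : Continuous fun v => D.matrixOf v 0 1 * D.matrixOf v 1 1 := by
    refine (((hi.mul hd2).sub hcd).div hN hne).congr fun v => ?_
    simp only [Pi.sub_apply, Pi.mul_apply, Pi.div_apply]
    rw [div_eq_iff (hne v)]
    simp only [rowNormSq, rowInner]
    linear_combination (D.matrixOf v 1 0 * D.matrixOf v 1 1) * det_SL2 (D.matrixOf v)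
  have hadbc : Continuous fun v => D.matrixOf v 0 0 * D.matrixOf v 1 1
      + D.matrixOf v 0 1 * D.matrixOf v 1 0 := by
    refine ((he.add (continuous_const.mul (hi.mul hcd) : Continuous fun v => (2 : ℝ) * _)).div
      hN hne).congr fun v => ?_
    simp only [Pi.add_apply, Pi.mul_apply, Pi.div_apply]
    rw [div_eq_iff (hne v)]
    simp only [rowNormSq, rowInner]
    linear_combination (D.matrixOf v 1 0 ^ 2 - D.matrixOf v 1 1 ^ 2) * det_SL2 (D.matrixOf v)
  have ha : ∀ i j, Continuous fun q : UnitTangent D.foliation D.metric × SL(2, ℝ) => q.2 i j :=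
    fun i j => (continuous_entry i j).comp continuous_snd
  have e00 := ha 0 0
  have e01 := ha 0 1
  have e10 := ha 1 0
  have e11 := ha 1 1
  have f1 := hc2.comp (continuous_fst (Y := SL(2, ℝ)))
  have f2 := hd2.comp (continuous_fst (Y := SL(2, ℝ)))
  have f3 := hcd.comp (continuous_fst (Y := SL(2, ℝ)))
  have f4 := hac.comp (continuous_fst (Y := SL(2, ℝ)))
  have f5 := hbd.comp (continuous_fst (Y := SL(2, ℝ)))
  have f6 := hadbc.comp (continuous_fst (Y := SL(2, ℝ)))
  simp only [Function.comp_def] at f1 f2 f3 f4 f5 f6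
  have hr : ∀ (q : UnitTangent D.foliation D.metric × SL(2, ℝ)) (i j : Fin 2),
      (D.matrixOf q.1 * q.2) i j = D.matrixOf q.1 i 0 * q.2 0 j + D.matrixOf q.1 i 1 * q.2 1 j := by
    intro q i j
    simp [Matrix.mul_apply, Fin.sum_univ_two]
  refine D.continuous_unitFrame_comp ?_ ?_ ?_ ?_ (D.continuous_heightOf.comp continuous_fst)
  · refine (((f1.mul ((e00.pow 2).add (e01.pow 2))).add
      (f2.mul ((e10.pow 2).add (e11.pow 2)))).add
      (f3.mul (((e00.mul e10).add (e01.mul e11)).mul continuous_const : Continuous fun q =>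
        _ * (2 : ℝ)))).congr fun q => ?_
    simp only [rowNormSq, hr,
      Pi.add_apply, Pi.mul_apply, Pi.pow_apply]
    ring
  · refine (((f4.mul ((e00.pow 2).add (e01.pow 2))).add
      (f5.mul ((e10.pow 2).add (e11.pow 2)))).add
      (f6.mul ((e00.mul e10).add (e01.mul e11)))).congr fun q => ?_
    simp only [rowInner, hr,
      Pi.add_apply, Pi.mul_apply, Pi.pow_apply]
    ring
  · refine (((f1.mul (e00.mul e01)).add (f2.mul (e10.mul e11))).add
      (f3.mul ((e00.mul e11).add (e01.mul e10)))).congr fun q => ?_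
    simp only [hr,
      Pi.add_apply, Pi.mul_apply]
    ring
  · refine (((f1.mul ((e01.pow 2).sub (e00.pow 2))).add
      (f2.mul ((e11.pow 2).sub (e10.pow 2)))).add
      (f3.mul (((e01.mul e11).sub (e00.mul e10)).mul continuous_const : Continuous fun q =>
        _ * (2 : ℝ)))).congr fun q => ?_
    simp only [hr,
      Pi.add_apply, Pi.sub_apply, Pi.mul_apply, Pi.pow_apply]
    ring

/-- The leafwise hyperbolic structure of the foliation of `T³_A`. -/
def hyperbolicStructure : LeafwiseHyperbolicStructure D.foliation where
  metric := D.metric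
  metric_invariant γ x v w := by
    obtain ⟨n, hn, hd⟩ := mfderiv_smul γ
    exact (congrArg₂ (fun a b : (Fin 2 → ℝ) × ℝ => D.metricForm (γ • x) a b) (hd x v)
      (hd x w)).trans (D.metricForm_smul n x (γ • x) v w (hn x))
  unif v := D.leafMap (D.matrixOf v) (D.heightOf v)
  isLeafUniformization v := D.isLeafUniformization_leafMap _ _
  frame_unif v := congrArg Subtype.val (D.unitFrame_matrixOf v)
  unif_move v a z := by
    rw [leafMap_smul]
    refine congrFun (D.leafMap_eq_of_unitFrame_eq ?_) z
    rw [unitFrame_matrixOf, moveFrame_leafMap]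
  unif_smul γ v w h z := by
    obtain ⟨n, m, hγ⟩ := exists_apply_eq γ
    obtain ⟨s, hs, hsn⟩ := D.exists_sq_eq_zpow n
    have hγ' : ∀ p : (Fin 2 → ℝ) × ℝ,
        γ • p = linearPart A n p + (latticePoint m + (0, (n : ℝ))) := fun p => by
      rw [hγ, add_assoc]
    have hl := D.smul_leafMap hγ' (by simp [latticePoint]) hs.ne' hsn (D.matrixOf v) (D.heightOf v)
    rw [show γ • D.leafMap (D.matrixOf v) (D.heightOf v) z
      = (fun z => γ • D.leafMap (D.matrixOf v) (D.heightOf v) z) z from rfl, hl]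
    refine congrFun (D.leafMap_eq_of_unitFrame_eq ?_) z
    rw [unitFrame_matrixOf]
    apply Subtype.ext
    rw [h, D.tangentMap_unitFrame hl, unitFrame_matrixOf]
  continuous_move := by
    refine D.continuous_unitFrame_matrixOf_mul.congr fun q => ?_
    exact (D.moveFrame_leafMap _ _ _).symm

/-- The action is right multiplication in the group coordinates, whatever representatives were
chosen to define the uniformizations. -/
lemma move_unitFrame (g a : SL(2, ℝ)) (y : ℝ) :
    D.hyperbolicStructure.move (D.unitFrame g y) a = D.unitFrame (g * a) y := by
  have h : D.leafMap (D.matrixOf (D.unitFrame g y)) (D.heightOf (D.unitFrame g y))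
      = D.leafMap g y := D.leafMap_eq_of_unitFrame_eq (D.unitFrame_matrixOf _)
  apply Subtype.ext
  change frame (E := (Fin 2 → ℝ) × ℝ) (fun z =>
    D.leafMap (D.matrixOf (D.unitFrame g y)) (D.heightOf (D.unitFrame g y)) (a • z)) = _
  rw [h]
  simp only [leafMap_smul, unitFrame]

end Eigenbasis

/-! ### Minimal sets -/

lemma not_isMinimal_of_isClosed {G X : Type*} [Group G] [TopologicalSpace X] [MulAction G X]
    {S : Set X} (hS : IsClosed S) (hinv : ∀ (a : G), ∀ x ∈ S, a • x ∈ S) (hne : S.Nonempty)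
    (hne' : S ≠ Set.univ) : ¬ MulAction.IsMinimal G X := by
  intro h
  rcases eq_empty_or_univ_of_smul_invariant_closed G hS (fun a => by
    rintro _ ⟨x, hx, rfl⟩
    exact hinv a x hx) with h0 | h0
  · exact hne.ne_empty h0
  · exact hne' h0

/-- The lower triangular unipotent matrix. -/
def lowerSL2 (e : ℝ) : SL(2, ℝ) := ⟨!![1, 0; e, 1], by simp⟩

lemma continuous_lowerSL2 : Continuous lowerSL2 := by
  refine Continuous.subtype_mk ?_ _
  refine continuous_matrix fun i j => ?_
  fin_cases i <;> fin_cases j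
  · exact continuous_const
  · exact continuous_const
  · exact continuous_id
  · exact continuous_const

lemma mem_subgroupB_iff {g : SL(2, ℝ)} : g ∈ subgroupB ↔ g 1 0 = 0 ∧ 0 < g 0 0 ∧ 0 < g 1 1 :=
  Iff.rfl

lemma mem_subgroupU_iff {g : SL(2, ℝ)} : g ∈ subgroupU ↔ g 1 0 = 0 ∧ g 0 0 = 1 ∧ g 1 1 = 1 :=
  Iff.rfl

lemma subgroupU_le_subgroupB : subgroupU ≤ subgroupB := by
  intro g hg
  obtain ⟨h1, h2, h3⟩ := mem_subgroupU_iff.mp hg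
  exact mem_subgroupB_iff.mpr ⟨h1, by rw [h2]; exact one_pos, by rw [h3]; exact one_pos⟩

lemma mem_subgroupB_of_pos {g : SL(2, ℝ)} (h : g 1 0 = 0) (h0 : 0 < g 0 0) : g ∈ subgroupB := by
  have hd := det_SL2 g
  rw [h, mul_zero, sub_zero] at hd
  exact mem_subgroupB_iff.mpr ⟨h, h0, (pos_iff_pos_of_mul_pos (by rw [hd]; exact one_pos)).mp h0⟩

lemma affineSL2_mem_subgroupB {s b : ℝ} (hs : 0 < s) : affineSL2 s b hs.ne' ∈ subgroupB :=
  mem_subgroupB_of_pos (by simp [affineSL2]) (by simpa [affineSL2] using hs)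

/-- Right multiplication by `B` fixes the endpoint `g ∞ = a / c`, so `c / a` labels the orbit and
the lower unipotent matrix is its normal form. -/
lemma exists_mul_eq_lowerSL2 {g : SL(2, ℝ)} (h : 0 < g 0 0) :
    ∃ b ∈ subgroupB, g * b = lowerSL2 (g 1 0 / g 0 0) := by
  refine ⟨g⁻¹ * lowerSL2 (g 1 0 / g 0 0), ?_, mul_inv_cancel_left _ _⟩
  have hd := det_SL2 g
  have h10 : (g⁻¹ * lowerSL2 (g 1 0 / g 0 0)) 1 0 = 0 := by
    rw [Matrix.SpecialLinearGroup.coe_mul, Matrix.SpecialLinearGroup.coe_inv]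
    simp [lowerSL2, Matrix.adjugate_fin_two, Matrix.mul_apply, Fin.sum_univ_two]
    field_simp
    ring
  have h00 : (g⁻¹ * lowerSL2 (g 1 0 / g 0 0)) 0 0 = (g 0 0)⁻¹ := by
    rw [Matrix.SpecialLinearGroup.coe_mul, Matrix.SpecialLinearGroup.coe_inv]
    simp [lowerSL2, Matrix.adjugate_fin_two, Matrix.mul_apply, Fin.sum_univ_two]
    field_simp
    linear_combination hd
  exact mem_subgroupB_of_pos h10 (by rw [h00]; exact inv_pos.mpr h)

/-! ### The unit tangent bundle of `T³_A` in group coordinates -/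

namespace Eigenbasis

variable {A : SL(2, ℤ)} (D : Eigenbasis A)

/-- The vector of the unit tangent bundle of the foliation of `T³_A` defined by an element of
`SL(2, ℝ)` and the height of a leaf. -/
def point (g : SL(2, ℝ)) (y : ℝ) : D.hyperbolicStructure.UnitTangentBundle :=
  Quotient.mk D.hyperbolicStructure.setoid (D.unitFrame g y)

lemma exists_point_eq (q : D.hyperbolicStructure.UnitTangentBundle) : ∃ g y, D.point g y = q := by
  obtain ⟨v, rfl⟩ := Quotient.exists_rep q
  obtain ⟨g, y, h⟩ := D.exists_unitFrame_eq v
  exact ⟨g, y, congrArg (Quotient.mk D.hyperbolicStructure.setoid) h⟩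

lemma continuous_point : Continuous fun q : SL(2, ℝ) × ℝ => D.point q.1 q.2 :=
  (continuous_quotient_mk' (s := D.hyperbolicStructure.setoid)).comp D.continuous_unitFrame

lemma op_smul_point (g a : SL(2, ℝ)) (y : ℝ) :
    MulOpposite.op a • D.point g y = D.point (g * a) y :=
  congrArg (Quotient.mk D.hyperbolicStructure.setoid) (D.move_unitFrame g a y)

lemma point_neg (g : SL(2, ℝ)) (y : ℝ) : D.point (-g) y = D.point g y := by
  refine congrArg (Quotient.mk D.hyperbolicStructure.setoid) (Subtype.ext ?_)
  have : D.leafMap (-g) y = D.leafMap g y := by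
    funext z
    simp only [leafMap, neg_smul_upperHalfPlane]
  simp only [unitFrame, this]

lemma point_affineSL2_mul {γ : groupT3 A} {n : ℤ} {q : (Fin 2 → ℝ) × ℝ}
    (hγ : ∀ p : (Fin 2 → ℝ) × ℝ, γ • p = linearPart A n p + q) (hq : q.2 = n)
    {s : ℝ} (hs : s ≠ 0) (hsn : s ^ 2 = D.l ^ n) (g : SL(2, ℝ)) (y : ℝ) :
    D.point (affineSL2 s (D.xCoord q) hs * g) (D.l ^ (-n) * y + D.yCoord q) = D.point g y :=
  (Quotient.sound (s := D.hyperbolicStructure.setoid)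
    ⟨γ, D.tangentMap_unitFrame (D.smul_leafMap hγ hq hs hsn g y)⟩).symm

lemma point_translation (m : Fin 2 → ℤ) (g : SL(2, ℝ)) (y : ℝ) :
    D.point (affineSL2 1 (D.xCoord (latticePoint m)) one_ne_zero * g)
      (y + D.yCoord (latticePoint m)) = D.point g y := by
  obtain ⟨γ, hγ⟩ := exists_translation A m
  have h := D.point_affineSL2_mul (γ := γ) (n := 0) (q := latticePoint m)
    (fun p => by rw [hγ, linearPart_zero]) (by simp [latticePoint]) one_ne_zero (by simp) g y
  simpa using h

lemma point_suspension (n : ℤ) {s : ℝ} (hs : s ≠ 0) (hsn : s ^ 2 = D.l ^ n) (g : SL(2, ℝ))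
    (y : ℝ) : D.point (affineSL2 s 0 hs * g) (D.l ^ (-n) * y) = D.point g y := by
  obtain ⟨γ, hγ⟩ := exists_suspension A n
  have hx : D.xCoord ((0 : Fin 2 → ℝ), (n : ℝ)) = 0 := by simp [xCoord_apply, det2]
  have hy : D.yCoord ((0 : Fin 2 → ℝ), (n : ℝ)) = 0 := by simp [yCoord_apply, det2]
  have h := D.point_affineSL2_mul hγ rfl hs hsn g y
  simp only [hx, hy, add_zero] at h
  exact h

/-! ### Invariant functions -/

/-- Deck transformations shift `t` by integers and preserve the `t`-component of vectors; this is
what lets `cosine` and `cosHeight` descend to the quotient. -/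
lemma toVector_of_related {v w : UnitTangent D.foliation D.metric}
    (h : D.hyperbolicStructure.setoid v w) : ∃ n : ℤ,
    (D.toVector w).1.2 = (D.toVector v).1.2 + n ∧ (D.toVector w).2.2 = (D.toVector v).2.2 := by
  obtain ⟨γ, hγ⟩ := h
  obtain ⟨n, hn, hd⟩ := mfderiv_smul γ
  refine ⟨n, ?_, ?_⟩
  · have : (D.toVector w).1 = γ • (D.toVector v).1 :=
      congrArg (fun q : TangentBundle 𝓘(ℝ, (Fin 2 → ℝ) × ℝ) ((Fin 2 → ℝ) × ℝ) => q.1) hγ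
    rw [this, hn]
  · have h1 : (D.toVector w).2 = _ :=
      congrArg (fun q : TangentBundle 𝓘(ℝ, (Fin 2 → ℝ) × ℝ) ((Fin 2 → ℝ) × ℝ) =>
        (q.2 : (Fin 2 → ℝ) × ℝ)) hγ
    have h2 : (D.toVector w).2 = linearPart A n (D.toVector v).2 :=
      h1.trans (hd (D.toVector v).1 (D.toVector v).2)
    rw [h2, linearPart_apply]

/-- The cosine of the angle between a vector and the upward direction. -/
def cosine : D.hyperbolicStructure.UnitTangentBundle → ℝ :=
  Quotient.lift (fun v : UnitTangent D.foliation D.metric => (D.toVector v).2.2 * Real.log D.l)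
    fun v w h => by
      obtain ⟨n, -, h⟩ := D.toVector_of_related h
      simp only [h]

/-- The cosine of `2 π t`, where `t` is the third coordinate of the base point of a vector. -/
def cosHeight : D.hyperbolicStructure.UnitTangentBundle → ℝ :=
  Quotient.lift
    (fun v : UnitTangent D.foliation D.metric => Real.cos ((D.toVector v).1.2 * (2 * Real.pi)))
    fun v w h => by
      obtain ⟨n, h, -⟩ := D.toVector_of_related h
      simp only [h, add_mul, Real.cos_add_int_mul_two_pi]

lemma continuous_cosine : Continuous D.cosine :=
  Continuous.quotient_lift ((continuous_snd.comp
    (continuous_snd.comp D.continuous_toVector)).mul continuous_const) _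

lemma continuous_cosHeight : Continuous D.cosHeight :=
  Continuous.quotient_lift (Real.continuous_cos.comp ((continuous_snd.comp
    (continuous_fst.comp D.continuous_toVector)).mul continuous_const)) _

lemma cosine_point (g : SL(2, ℝ)) (y : ℝ) :
    D.cosine (D.point g y) = (g 1 1 ^ 2 - g 1 0 ^ 2) / rowNormSq g := by
  change (D.toVector (D.unitFrame g y)).2.2 * Real.log D.l = _
  have hl := D.log_l_pos.ne'
  have hN := (rowNormSq_pos g).ne'
  rw [toVector_unitFrame, frameVector]
  field_simp

lemma cosHeight_point (g : SL(2, ℝ)) (y : ℝ) : D.cosHeight (D.point g y)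
    = Real.cos (-Real.log (rowNormSq g) / Real.log D.l * (2 * Real.pi)) := by
  change Real.cos ((D.toVector (D.unitFrame g y)).1.2 * (2 * Real.pi)) = _
  rw [toVector_unitFrame, frameVector]

/-! ### The upward vectors -/

/-- The set of the upward unit vectors. -/
def upwardSet : Set D.hyperbolicStructure.UnitTangentBundle := D.cosine ⁻¹' {1}

lemma isClosed_upwardSet : IsClosed D.upwardSet := isClosed_singleton.preimage D.continuous_cosine

/-- The cosine is `(d² - c²) / (d² + c²)`, which equals one exactly when `c = 0`. -/
lemma point_mem_upwardSet_iff (g : SL(2, ℝ)) (y : ℝ) :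
    D.point g y ∈ D.upwardSet ↔ g 1 0 = 0 := by
  have hN := (rowNormSq_pos g).ne'
  change D.cosine (D.point g y) = 1 ↔ _
  rw [cosine_point, div_eq_one_iff_eq hN, rowNormSq]
  constructor
  · intro h
    have : g 1 0 ^ 2 = 0 := by linarith
    exact (pow_eq_zero_iff two_ne_zero).mp this
  · intro h
    rw [h]; ring

lemma op_smul_mem_upwardSet {a : SL(2, ℝ)} (ha : a ∈ subgroupB)
    {q : D.hyperbolicStructure.UnitTangentBundle} (hq : q ∈ D.upwardSet) :
    MulOpposite.op a • q ∈ D.upwardSet := by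
  obtain ⟨g, y, rfl⟩ := D.exists_point_eq q
  rw [point_mem_upwardSet_iff] at hq
  rw [op_smul_point, point_mem_upwardSet_iff, Matrix.SpecialLinearGroup.coe_mul]
  simp [Matrix.mul_apply, Fin.sum_univ_two, hq, (mem_subgroupB_iff.mp ha).1]

lemma upwardSet_nonempty : D.upwardSet.Nonempty :=
  ⟨D.point 1 0, (D.point_mem_upwardSet_iff 1 0).mpr (by simp)⟩

lemma upwardSet_ne_univ : D.upwardSet ≠ Set.univ := by
  intro h
  have : D.point (lowerSL2 1) 0 ∈ D.upwardSet := by rw [h]; trivial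
  rw [point_mem_upwardSet_iff] at this
  simp [lowerSL2] at this

lemma not_isMinimal_subgroupB :
    ¬ MulAction.IsMinimal subgroupB.op D.hyperbolicStructure.UnitTangentBundle :=
  not_isMinimal_of_isClosed D.isClosed_upwardSet
    (fun a _ hq => D.op_smul_mem_upwardSet (a := a.1.unop) a.2 hq)
    D.upwardSet_nonempty D.upwardSet_ne_univ

lemma not_isMinimal_subgroupU :
    ¬ MulAction.IsMinimal subgroupU.op D.hyperbolicStructure.UnitTangentBundle :=
  not_isMinimal_of_isClosed D.isClosed_upwardSet
    (fun a _ hq => D.op_smul_mem_upwardSet (a := a.1.unop) (subgroupU_le_subgroupB a.2) hq)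
    D.upwardSet_nonempty D.upwardSet_ne_univ

lemma exists_mem_subgroupB_of_mem_upwardSet {q : D.hyperbolicStructure.UnitTangentBundle}
    (hq : q ∈ D.upwardSet) : ∃ g ∈ subgroupB, ∃ y, D.point g y = q := by
  obtain ⟨g, y, rfl⟩ := D.exists_point_eq q
  rw [point_mem_upwardSet_iff] at hq
  have hd := det_SL2 g
  rw [hq, mul_zero, sub_zero] at hd
  have h0 : g 0 0 ≠ 0 := fun h => by simp [h] at hd
  rcases lt_or_gt_of_ne h0 with h | h
  · refine ⟨-g, mem_subgroupB_of_pos ?_ ?_, y, D.point_neg g y⟩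
    · simp [Matrix.SpecialLinearGroup.coe_neg, hq]
    · simpa [Matrix.SpecialLinearGroup.coe_neg] using h
  · exact ⟨g, mem_subgroupB_of_pos hq h, y, rfl⟩

/-- A closed nonempty set of upward vectors which is invariant under `B` contains all the upward
vectors. -/
lemma upwardSet_subset {T : Set D.hyperbolicStructure.UnitTangentBundle} (hT : IsClosed T)
    (hne : T.Nonempty) (hinv : ∀ a ∈ subgroupB, ∀ q ∈ T, MulOpposite.op a • q ∈ T)
    (hsub : T ⊆ D.upwardSet) : D.upwardSet ⊆ T := by
  obtain ⟨q, hq⟩ := hne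
  obtain ⟨g, hg, y, rfl⟩ := D.exists_mem_subgroupB_of_mem_upwardSet (hsub hq)
  have hall : ∀ b ∈ subgroupB, D.point b y ∈ T := by
    intro b hb
    have := hinv (g⁻¹ * b) (mul_mem (inv_mem hg) hb) _ hq
    rwa [op_smul_point, mul_inv_cancel_left] at this
  intro q' hq'
  obtain ⟨b, hb, y', rfl⟩ := D.exists_mem_subgroupB_of_mem_upwardSet hq'
  have hcl : IsClosed ((fun y => D.point b y) ⁻¹' T) :=
    hT.preimage (D.continuous_point.comp (Continuous.prodMk_right b))
  have hd : DenseRange fun m : Fin 2 → ℤ => y + D.yCoord (latticePoint m) :=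
    (Homeomorph.addLeft y).surjective.denseRange.comp D.dense_range_yCoord
      (Homeomorph.addLeft y).continuous
  have hsub' : (Set.range fun m : Fin 2 → ℤ => y + D.yCoord (latticePoint m)) ⊆
      (fun y => D.point b y) ⁻¹' T := by
    rintro _ ⟨m, rfl⟩
    -- The set already contains all of `B` at height `y`. A lattice translation changes the height,
    -- and the upper triangular matrix which it introduces on the left is absorbed into `B`.
    have h := D.point_translation m
      ((affineSL2 1 (D.xCoord (latticePoint m)) one_ne_zero)⁻¹ * b) y
    rw [mul_inv_cancel_left] at h
    rw [Set.mem_preimage, h]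
    exact hall _ (mul_mem (inv_mem (affineSL2_mem_subgroupB one_pos)) hb)
  exact hcl.closure_subset_iff.mpr hsub' (hd y')

/-- The `n`-th power of the suspension dilates the endpoint `a / c` by `l^n` and contracts the
height by `l^(-n)`, without changing the point of the quotient; an element of `B` then restores the
normal form. -/
lemma point_lowerSL2_mem {T : Set D.hyperbolicStructure.UnitTangentBundle}
    (hinv : ∀ a ∈ subgroupB, ∀ q ∈ T, MulOpposite.op a • q ∈ T) {g : SL(2, ℝ)} {y : ℝ}
    (hgy : D.point g y ∈ T) (hg : 0 < g 0 0) (n : ℕ) :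
    D.point (lowerSL2 (g 1 0 / g 0 0 * D.l⁻¹ ^ n)) (D.l⁻¹ ^ n * y) ∈ T := by
  obtain ⟨s, hs, hsn⟩ := D.exists_sq_eq_zpow n
  have h := D.point_suspension n hs.ne' hsn g y
  rw [← h] at hgy
  obtain ⟨h00, h10⟩ := affineSL2_mul_row s 0 hs.ne' g
  rw [zero_div, zero_mul, add_zero] at h00
  obtain ⟨b, hb, hgb⟩ := exists_mul_eq_lowerSL2 (g := affineSL2 s 0 hs.ne' * g)
    (by rw [h00]; exact mul_pos hs hg)
  have h2 := hinv b hb _ hgy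
  rw [op_smul_point, hgb, h00, h10] at h2
  have e0 : D.l⁻¹ ^ n = (s ^ 2)⁻¹ := by rw [hsn, zpow_natCast, inv_pow]
  have e1 : s⁻¹ * g 1 0 / (s * g 0 0) = g 1 0 / g 0 0 * D.l⁻¹ ^ n := by
    rw [e0]
    field_simp
  rw [e1, zpow_neg, zpow_natCast, ← inv_pow] at h2
  exact h2

/-- A vanishing upper left entry means that the endpoint of the frame is `0`. A lattice translation
with nonzero `x'`-coordinate moves this endpoint away, and the sign of the matrix is free. -/
lemma exists_point_mem_pos {T : Set D.hyperbolicStructure.UnitTangentBundle} (hne : T.Nonempty) :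
    ∃ g y, D.point g y ∈ T ∧ 0 < g 0 0 := by
  obtain ⟨q, hq⟩ := hne
  obtain ⟨g, y, rfl⟩ := D.exists_point_eq q
  obtain ⟨g, y, hgy, hg⟩ : ∃ g y, D.point g y ∈ T ∧ g 0 0 ≠ 0 := by
    by_cases h : g 0 0 = 0
    · obtain ⟨m, hm⟩ := D.exists_xCoord_ne_zero
      refine ⟨_, _, (D.point_translation m g y).symm ▸ hq, ?_⟩
      have hd := det_SL2 g
      rw [(affineSL2_mul_row _ _ _ g).1, h, mul_zero, zero_add, div_one]
      refine mul_ne_zero hm fun hc => ?_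
      simp [h, hc] at hd
    · exact ⟨g, y, hq, h⟩
  rcases lt_or_gt_of_ne hg with h | h
  · exact ⟨-g, y, (D.point_neg g y).symm ▸ hgy, by
      simpa [Matrix.SpecialLinearGroup.coe_neg] using h⟩
  · exact ⟨g, y, hgy, h⟩

/-- A closed nonempty set which is invariant under `B` contains upward vectors. -/
lemma inter_upwardSet_nonempty {T : Set D.hyperbolicStructure.UnitTangentBundle} (hT : IsClosed T)
    (hne : T.Nonempty) (hinv : ∀ a ∈ subgroupB, ∀ q ∈ T, MulOpposite.op a • q ∈ T) :
    (T ∩ D.upwardSet).Nonempty := by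
  obtain ⟨g, y, hgy, hg⟩ := D.exists_point_mem_pos hne
  have hlim : Filter.Tendsto (fun n : ℕ => D.l⁻¹ ^ n) Filter.atTop (nhds 0) :=
    tendsto_pow_atTop_nhds_zero_of_lt_one (inv_pos.mpr D.l_pos).le (inv_lt_one_of_one_lt₀ D.one_lt)
  have hlow : Continuous fun r : ℝ => (lowerSL2 (g 1 0 / g 0 0 * r), r * y) :=
    (continuous_lowerSL2.comp (continuous_const_mul _)).prodMk (continuous_mul_const y)
  have hc := D.continuous_point.comp hlow
  -- The normal forms converge to the identity matrix at height `0`, which is an upward vector.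
  have hmem : D.point (lowerSL2 (g 1 0 / g 0 0 * 0)) (0 * y) ∈ T :=
    hT.mem_of_tendsto ((hc.tendsto 0).comp hlim)
      (Filter.Eventually.of_forall fun n => D.point_lowerSL2_mem hinv hgy hg n)
  exact ⟨_, hmem, (D.point_mem_upwardSet_iff _ _).mpr (by simp [lowerSL2])⟩

lemma isMinimalSet_upwardSet : IsMinimalSet subgroupB.op D.upwardSet := by
  refine ⟨⟨D.isClosed_upwardSet, D.upwardSet_nonempty,
    fun a _ hq => D.op_smul_mem_upwardSet (a := a.1.unop) a.2 hq⟩, ?_⟩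
  rintro T ⟨hT, hne, hinv⟩ hsub
  exact D.upwardSet_subset hT hne (fun a ha q hq => hinv ⟨MulOpposite.op a, ha⟩ q hq) hsub

/-- A minimal set meets the upward set in a nonempty closed invariant set, so it lies inside the
upward set, which is itself minimal. -/
lemma eq_upwardSet_of_isMinimalSet {T : Set D.hyperbolicStructure.UnitTangentBundle}
    (hT : IsMinimalSet subgroupB.op T) : T = D.upwardSet := by
  obtain ⟨⟨hcl, hne, hinv⟩, hmin⟩ := hT
  have hinter := D.inter_upwardSet_nonempty hcl hne
    (fun a ha q hq => hinv ⟨MulOpposite.op a, ha⟩ q hq)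
  have hsub : T ⊆ T ∩ D.upwardSet := hmin ⟨hcl.inter D.isClosed_upwardSet, hinter,
    fun a q hq => ⟨hinv a q hq.1, D.op_smul_mem_upwardSet (a := a.1.unop) a.2 hq.2⟩⟩
    Set.inter_subset_left
  exact Set.Subset.antisymm (hsub.trans Set.inter_subset_right)
    (D.isMinimalSet_upwardSet.2 ⟨hcl, hne, hinv⟩ (hsub.trans Set.inter_subset_right))

lemma not_isMinimalSet_upwardSet_subgroupU : ¬ IsMinimalSet subgroupU.op D.upwardSet := by
  rintro ⟨-, hmin⟩
  have hl := D.log_l_pos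
  have h1 : D.point 1 0 ∈ D.upwardSet ∩ D.cosHeight ⁻¹' {1} := by
    refine ⟨(D.point_mem_upwardSet_iff 1 0).mpr (by simp), ?_⟩
    rw [Set.mem_preimage, cosHeight_point]
    simp [rowNormSq]
  have hinv : ∀ a : subgroupU.op, ∀ q ∈ D.upwardSet ∩ D.cosHeight ⁻¹' {1},
      a • q ∈ D.upwardSet ∩ D.cosHeight ⁻¹' {1} := by
    rintro ⟨a, ha⟩ q ⟨hq, hq'⟩
    obtain ⟨a, rfl⟩ := MulOpposite.op_surjective a
    refine ⟨D.op_smul_mem_upwardSet (subgroupU_le_subgroupB ha) hq, ?_⟩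
    obtain ⟨g, y, rfl⟩ := D.exists_point_eq q
    change D.cosHeight (MulOpposite.op a • D.point g y) = 1
    rw [point_mem_upwardSet_iff] at hq
    obtain ⟨ha1, ha2, ha3⟩ := mem_subgroupU_iff.mp (show a ∈ subgroupU from ha)
    -- For an upper triangular matrix, right multiplication by a unipotent one keeps the entry `d`,
    -- hence the height `t = -log (d²) / log l`.
    have hN : rowNormSq (g * a) = rowNormSq g := by
      rw [rowNormSq, Matrix.SpecialLinearGroup.coe_mul]
      simp [Matrix.mul_apply, Fin.sum_univ_two, hq, ha1, ha3, rowNormSq]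
    rw [op_smul_point, cosHeight_point, hN, ← cosHeight_point]
    exact hq'
  have hsub : D.upwardSet ⊆ D.upwardSet ∩ D.cosHeight ⁻¹' {1} :=
    hmin ⟨D.isClosed_upwardSet.inter (isClosed_singleton.preimage D.continuous_cosHeight),
      ⟨_, h1⟩, hinv⟩ Set.inter_subset_left
  -- With `s = l^(1/4)` the base point has imaginary part `s² = l^(1/2)`, so `t = 1/2` and the
  -- cosine of `2 π t` is `-1`.
  have hs : 0 < Real.exp (Real.log D.l / 4) := Real.exp_pos _
  have hmem := hsub ((D.point_mem_upwardSet_iff (affineSL2 _ 0 hs.ne') 0).mpr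
    (by simp [affineSL2]))
  have hcos : D.cosHeight (D.point (affineSL2 _ 0 hs.ne') 0) = 1 := hmem.2
  have hN : Real.log (rowNormSq (affineSL2 _ 0 hs.ne')) = -(Real.log D.l / 2) := by
    have : rowNormSq (affineSL2 _ 0 hs.ne') = Real.exp (-(Real.log D.l / 2)) := by
      simp only [rowNormSq, affineSL2]
      simp only [Matrix.of_apply, Matrix.cons_val_zero, Matrix.cons_val_one,
        Matrix.cons_val', Matrix.cons_val_fin_one]
      rw [← Real.exp_neg, ← Real.exp_nat_mul]
      simp
      ring
    rw [this, Real.log_exp]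
  rw [cosHeight_point, hN, neg_neg,
    show Real.log D.l / 2 / Real.log D.l * (2 * Real.pi) = Real.pi by
    field_simp, Real.cos_pi] at hcos
  norm_num at hcos

lemma metric_inner_of_det2_eq_zero (p : (Fin 2 → ℝ) × ℝ) (w : Fin 2 → ℝ) (s : ℝ)
    (hw : det2 D.u w = 0) : D.hyperbolicStructure.metric.inner p (w, s) (w, s)
      = (det2 w D.v / D.l ^ p.2) ^ 2 + (Real.log D.l * s) ^ 2 := by
  refine (D.metricForm_self p (w, s)).trans ?_
  rw [yCoord_apply, hw, xCoord_apply]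
  ring

end Eigenbasis

end HorocycleFoliation

end

theorem theorem3 :
    (∃ (E M F N Γ : Type)
      (_ : NormedAddCommGroup E) (_ : NormedSpace ℝ E)
      (_ : TopologicalSpace M) (_ : ChartedSpace E M) (_ : IsManifold 𝓘(ℝ, E) ∞ M)
      (_ : NormedAddCommGroup F) (_ : NormedSpace ℝ F)
      (_ : TopologicalSpace N) (_ : ChartedSpace F N)
      (_ : Group Γ) (_ : MulAction Γ M)
      (𝓕 : TransverselyHomogeneousFoliation E M F N Γ) (h : LeafwiseHyperbolicStructure 𝓕),
      𝓕.IsMinimal ∧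
      ¬ MulAction.IsMinimal subgroupU.op h.UnitTangentBundle ∧
      ¬ MulAction.IsMinimal subgroupB.op h.UnitTangentBundle) ∧
    (∀ A : SL(2, ℤ), 2 < A.1.trace →
      ∃ (l : ℝ) (u v : Fin 2 → ℝ),
        1 < l ∧
        (A.1.map (Int.cast : ℤ → ℝ)).mulVec u = l • u ∧
        (A.1.map (Int.cast : ℤ → ℝ)).mulVec v = l⁻¹ • v ∧
        det2 u v = 1 ∧
        ∃ (𝓕 : TransverselyHomogeneousFoliation
            ((Fin 2 → ℝ) × ℝ) ((Fin 2 → ℝ) × ℝ) ℝ ℝ (groupT3 A))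
          (h : LeafwiseHyperbolicStructure 𝓕),
          (∀ p : (Fin 2 → ℝ) × ℝ, 𝓕.dev p = det2 u p.1) ∧
          (∀ (p : (Fin 2 → ℝ) × ℝ) (w : Fin 2 → ℝ) (s : ℝ), det2 u w = 0 →
            h.metric.inner p (w, s) (w, s) = (det2 w v / l ^ p.2) ^ 2 + (Real.log l * s) ^ 2) ∧
          𝓕.IsMinimal ∧
          ¬ MulAction.IsMinimal subgroupU.op h.UnitTangentBundle ∧
          ¬ MulAction.IsMinimal subgroupB.op h.UnitTangentBundle ∧
          ∃ S : Set h.UnitTangentBundle,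
            IsMinimalSet subgroupB.op S ∧
            (∀ S' : Set h.UnitTangentBundle, IsMinimalSet subgroupB.op S' → S' = S) ∧
            ¬ IsMinimalSet subgroupU.op S) := by
  constructor
  -- For existence any hyperbolic matrix will do; this one has trace `3`.
  · obtain ⟨D⟩ := nonempty_eigenbasis ⟨!![2, 1; 1, 1], by simp [Matrix.det_fin_two_of]⟩
      (by simp [Matrix.trace_fin_two])
    exact ⟨_, _, _, _, _, inferInstance, inferInstance, inferInstance, inferInstance,
      inferInstance, inferInstance, inferInstance, inferInstance, inferInstance, inferInstance,
      inferInstance, D.foliation, D.hyperbolicStructure, D.foliation_isMinimal,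
      D.not_isMinimal_subgroupU, D.not_isMinimal_subgroupB⟩
  · intro A hA
    obtain ⟨D⟩ := nonempty_eigenbasis A hA
    exact ⟨D.l, D.u, D.v, D.one_lt, D.map_u, D.map_v, D.det_eq_one, D.foliation,
      D.hyperbolicStructure, fun _ => rfl, D.metric_inner_of_det2_eq_zero, D.foliation_isMinimal,
      D.not_isMinimal_subgroupU, D.not_isMinimal_subgroupB, D.upwardSet,
      D.isMinimalSet_upwardSet, fun _ => D.eq_upwardSet_of_isMinimalSet,
      D.not_isMinimalSet_upwardSet_subgroupU⟩
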